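/- For an integer $a$, a positive integer $d$ and a real $x$, let $P_{(a,d)}(x)$ be the number of primes $p\le x$ with $p\equiv 1\pmod d$ and $a^{(p-1)/d}\equiv 1\pmod p$, and let $\pi(x)$ be the number of primes not exceeding $x$. Then there is an absolute constant $C>0$ such that for all real $x>1$ and $y\ge 1$ $$\left|\frac1y\sum_{2\le a\le y}P_{(a,2)}(x)-\frac{\pi(x)}2\right|\le\begin{cases} C\,x\sqrt{\dfrac{\log x}{y}}, & \text{if } y\le \dfrac{x}{\log x},\\[2ex] C\,\sqrt{x}\,\log x, & \text{if } y>\dfrac{x}{\log x},\end{cases}$$ where $a$ runs over all integers with $2\le a\le y$. -/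

import Mathlib

/-- The primes `p ≡ 1 (mod d)` for which `a ^ ((p - 1) / d) ≡ 1 (mod p)`.
For such `p` the division is exact when `d > 0`. -/
def residuePrimes (a : ℤ) (d : ℕ) : Set ℕ :=
  {p : ℕ | p.Prime ∧ p ≡ 1 [MOD d] ∧ a ^ ((p - 1) / d) ≡ 1 [ZMOD (p : ℤ)]}

/-- The number `P_{(a,d)}(x)` of primes in `residuePrimes a d` not exceeding the real `x`. -/
noncomputable def residuePrimeCount (a : ℤ) (d : ℕ) (x : ℝ) : ℕ :=
  {p : ℕ | p ∈ residuePrimes a d ∧ (p : ℝ) ≤ x}.ncard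

/-! By Euler's criterion, for an odd prime `p` the indicator of `a ^ ((p - 1) / 2) ≡ 1` is half of
`1 + (a/p)`, minus a correction when `p ∣ a`. Averaging over `a ≤ y` gives the main term `π(x)/2`,
harmless errors, and `1/(2y)` times the sum over `p ≤ x` of `S_p = ∑_{a ≤ N} (a/p)`, `N = ⌊y⌋`. All
rests on `∑_{p ≤ x} |S_p| ≪ x √(N log x)`. By dyadic splitting and Cauchy–Schwarz this follows from
a mean square bound `∑_{X < p ≤ 2X} S_p² ≪ X N log X`.

The engine is `sum_norm_sq_oddJacobi_le`. Primes are replaced by all odd `m` in `(X, 2X]`, the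
square is opened, and pairs `(h, k)` are separated. If `hk` is not a square, `m ↦ J(hk | m)` is a
non-principal character modulo `4hk`, so Pólya–Vinogradov and partial summation bound the sum over
`m`. If `hk` is a square, `h` and `k` share their squarefree part, and `sum_isSquare_mul_le` shows
that such pairs cost only a logarithm more than the diagonal.

This is sharp enough for at most about `√X` values of `a`. A longer sum is smoothed twice at scale
`D ≈ √X`; the edges are short sums, already covered. Expansion by Gauss sums turns the smooth part
into a dual sum of effective length `X / D ≲ √X`, whose coefficients vary slowly with `p`, and the
same engine applies (`sum_norm_sq_dual_le`). When `N ≥ X²`, Pólya–Vinogradov for each `p` is enough.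
-/

open Finset
open scoped NumberTheorySymbols

/-! ### Geometric exponential sums. -/

/-- The geometric exponential sum `∑_{1 ≤ n ≤ N} exp (2πinθ)`. -/
noncomputable def expSum (N : ℕ) (θ : ℝ) : ℂ :=
  ∑ n ∈ Icc 1 N, Complex.exp (2 * Real.pi * Complex.I * n * θ)

theorem norm_exp_two_pi_I_mul (n : ℕ) (θ : ℝ) :
    ‖Complex.exp (2 * Real.pi * Complex.I * n * θ)‖ = 1 := by
  have : (2 * Real.pi * Complex.I * n * θ : ℂ) = ((2 * Real.pi * n * θ : ℝ) : ℂ) * Complex.I := by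
    push_cast; ring
  rw [this, Complex.norm_exp_ofReal_mul_I]

theorem norm_expSum_le_card (N : ℕ) (θ : ℝ) : ‖expSum N θ‖ ≤ N := by
  refine (norm_sum_le _ _).trans ?_
  simp [norm_exp_two_pi_I_mul]

theorem expSum_one_sub (N : ℕ) (θ : ℝ) : expSum N (1 - θ) = (starRingEnd ℂ) (expSum N θ) := by
  unfold expSum
  rw [map_sum]
  refine sum_congr rfl fun n _ => ?_
  rw [← Complex.exp_conj]
  have h : (starRingEnd ℂ) (2 * Real.pi * Complex.I * n * θ) = -(2 * Real.pi * Complex.I * n * θ) := by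
    simp [Complex.conj_ofNat]
  rw [h]
  push_cast
  rw [mul_sub, mul_one, sub_eq_add_neg, Complex.exp_add]
  have : Complex.exp (2 * Real.pi * Complex.I * n) = 1 :=
    Complex.exp_eq_one_iff.2 ⟨n, by push_cast; ring⟩
  rw [this, one_mul]

/-- The geometric series has numerator at most 2 and denominator `|z - 1| = 2 sin(πθ) ≥ 4θ`, by
concavity of the sine. -/
theorem norm_expSum_le_inv {N : ℕ} {θ : ℝ} (h0 : 0 < θ) (h1 : θ ≤ 1 / 2) :
    ‖expSum N θ‖ ≤ 1 / (2 * θ) := by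
  set z : ℂ := Complex.exp (((2 * Real.pi * θ : ℝ) : ℂ) * Complex.I) with hz
  have hzn : ‖z‖ = 1 := Complex.norm_exp_ofReal_mul_I _
  have hsum : expSum N θ = z * ∑ n ∈ range N, z ^ n := by
    unfold expSum
    rw [mul_sum]
    refine sum_nbij' (· - 1) (· + 1) (by simp; omega) (by simp) (by simp; omega)
      (by simp) fun n hn => ?_
    rw [← pow_succ', Nat.sub_add_cancel (mem_Icc.1 hn).1, hz, ← Complex.exp_nat_mul]
    congr 1
    push_cast
    ring
  have hsub : ‖z - 1‖ = 2 * Real.sin (Real.pi * θ) := by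
    have := Complex.norm_exp_I_mul_ofReal_sub_one (2 * Real.pi * θ)
    rw [hz, mul_comm, this]
    have e : 2 * Real.pi * θ / 2 = Real.pi * θ := by ring
    rw [e, Real.norm_eq_abs, abs_of_nonneg]
    have := Real.sin_nonneg_of_nonneg_of_le_pi (x := Real.pi * θ) (by positivity)
      (by nlinarith [Real.pi_pos])
    linarith
  have hsin : 2 * θ ≤ Real.sin (Real.pi * θ) := by
    have := Real.mul_le_sin (x := Real.pi * θ) (by positivity) (by nlinarith [Real.pi_pos])
    have e : 2 / Real.pi * (Real.pi * θ) = 2 * θ := by field_simp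
    linarith
  have hg : (∑ n ∈ range N, z ^ n) * (z - 1) = z ^ N - 1 := geom_sum_mul z N
  have hgn : ‖∑ n ∈ range N, z ^ n‖ * ‖z - 1‖ ≤ 2 := by
    rw [← norm_mul, hg]
    refine (norm_sub_le _ _).trans ?_
    simp [hzn]; norm_num
  rw [hsum, norm_mul, hzn, one_mul, le_div_iff₀ (by positivity)]
  rw [hsub] at hgn
  nlinarith [norm_nonneg (∑ n ∈ range N, z ^ n)]

theorem norm_expSum_le_inv_add_inv {N : ℕ} {θ : ℝ} (h0 : 0 < θ) (h1 : θ < 1) :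
    ‖expSum N θ‖ ≤ 1 / (2 * θ) + 1 / (2 * (1 - θ)) := by
  rcases le_total θ (1 / 2) with h | h
  · have : 0 ≤ 1 / (2 * (1 - θ)) := by have : 0 < 1 - θ := by linarith
                                       positivity
    linarith [norm_expSum_le_inv (N := N) h0 h]
  · have h2 := norm_expSum_le_inv (N := N) (θ := 1 - θ) (by linarith) (by linarith)
    rw [expSum_one_sub, RCLike.norm_conj] at h2
    have : 0 ≤ 1 / (2 * θ) := by positivity
    linarith

/-! ### Gauss sums and the Pólya–Vinogradov inequality. -/

theorem DirichletCharacter.IsPrimitive.inv {q : ℕ} {χ : DirichletCharacter ℂ q} (hχ : χ.IsPrimitive) :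
    χ⁻¹.IsPrimitive := by
  rw [DirichletCharacter.isPrimitive_def, DirichletCharacter.conductor_inv]; exact hχ

section GaussSum

variable {q : ℕ} [NeZero q]

/-- In `conj(τ) τ`, primitivity lets `χ b` be absorbed into the conjugate sum as a shift by `b`.
Summing over `b` first, orthogonality of additive characters leaves only `a = 1`. -/
theorem norm_gaussSum_of_isPrimitive {χ : DirichletCharacter ℂ q} (hχ : χ.IsPrimitive) :
    ‖gaussSum χ ZMod.stdAddChar‖ = √q := by
  set ψ : AddChar (ZMod q) ℂ := ZMod.stdAddChar
  have key : star (gaussSum χ ψ) * gaussSum χ ψ = q := by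
    rw [star_gaussSum_eq]
    have h1 : ∀ b : ZMod q, gaussSum χ⁻¹ ψ⁻¹ * χ b = ∑ a, χ⁻¹ a * ψ (-(b * a)) := by
      intro b
      have := gaussSum_mulShift_of_isPrimitive ψ⁻¹ hχ.inv b
      rw [inv_inv, mul_comm] at this
      rw [← this, gaussSum]
      simp [AddChar.mulShift_apply]
    have h2 : gaussSum χ⁻¹ ψ⁻¹ * gaussSum χ ψ = ∑ b, (∑ a, χ⁻¹ a * ψ (-(b * a))) * ψ b := by
      conv_lhs => rw [gaussSum.eq_1 χ ψ, mul_sum]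
      refine sum_congr rfl fun b _ => ?_
      rw [← h1, mul_assoc]
    rw [h2]
    simp_rw [sum_mul]
    rw [sum_comm]
    have h3 : ∀ a : ZMod q, ∑ b, χ⁻¹ a * ψ (-(b * a)) * ψ b =
        χ⁻¹ a * ((if 1 - a = 0 then Fintype.card (ZMod q) else 0 : ℕ) : ℂ) := by
      intro a
      rw [← AddChar.sum_mulShift (1 - a) (ZMod.isPrimitive_stdAddChar q), mul_sum]
      refine sum_congr rfl fun b _ => ?_
      rw [mul_assoc, ← AddChar.map_add_eq_mul]
      congr 2
      ring
    rw [sum_congr rfl fun a _ => h3 a, sum_eq_single 1]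
    · simp [ZMod.card]
    · intro b _ hb
      rw [if_neg (by rw [sub_eq_zero]; exact fun h => hb h.symm), Nat.cast_zero, mul_zero]
    · simp
  have h2 : ‖gaussSum χ ψ‖ ^ 2 = q := by
    have := congrArg norm key
    rw [norm_mul, norm_star, Complex.norm_natCast] at this
    rw [sq, this]
  rw [← h2, Real.sqrt_sq (norm_nonneg _)]

theorem sum_zmod_eq_sum_range {M : Type*} [AddCommMonoid M] (f : ZMod q → M) :
    ∑ a, f a = ∑ h ∈ range q, f (h : ZMod q) := by
  refine sum_bij' (fun a _ => a.val) (fun h _ => (h : ZMod q)) ?_ ?_ ?_ ?_ ?_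
  · intro a _; simpa using ZMod.val_lt a
  · simp
  · intro a _; simp
  · intro h hh; exact ZMod.val_cast_of_lt (mem_range.1 hh)
  · intro a _; simp

/-- Expansion of a primitive character into additive characters. -/
theorem gaussSum_mul_apply_of_isPrimitive {χ : DirichletCharacter ℂ q} (hχ : χ.IsPrimitive) (n : ℕ) :
    gaussSum χ⁻¹ ZMod.stdAddChar * χ n =
      ∑ h ∈ range q, χ⁻¹ h * Complex.exp (2 * Real.pi * Complex.I * n * ((h / q : ℝ) : ℂ)) := by
  have := gaussSum_mulShift_of_isPrimitive (ZMod.stdAddChar (N := q)) hχ.inv n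
  rw [inv_inv, mul_comm] at this
  rw [← this, gaussSum, sum_zmod_eq_sum_range]
  refine sum_congr rfl fun h _ => ?_
  rw [AddChar.mulShift_apply]
  have e : ((n : ZMod q) * (h : ZMod q)) = (((n * h : ℕ) : ℤ) : ZMod q) := by push_cast; ring
  rw [e, ZMod.stdAddChar_coe]
  congr 2
  push_cast
  ring

theorem sum_apply_of_isPrimitive {χ : DirichletCharacter ℂ q} (hχ : χ.IsPrimitive) (N : ℕ) :
    gaussSum χ⁻¹ ZMod.stdAddChar * ∑ n ∈ Icc 1 N, χ n =
      ∑ h ∈ range q, χ⁻¹ h * expSum N (h / q) := by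
  rw [mul_sum, sum_congr rfl fun n _ => gaussSum_mul_apply_of_isPrimitive hχ n, sum_comm]
  simp_rw [expSum, mul_sum]

theorem sum_Icc_inv_le (N : ℕ) : ∑ h ∈ Icc 1 N, (1 : ℝ) / h ≤ 1 + Real.log N := by
  have := harmonic_le_one_add_log N
  rw [harmonic_eq_sum_Icc] at this
  push_cast at this
  simpa [one_div] using this

/-- The Pólya–Vinogradov inequality for primitive characters. -/
theorem norm_sum_le_of_isPrimitive (hq : 1 < q) {χ : DirichletCharacter ℂ q} (hχ : χ.IsPrimitive)
    (N : ℕ) : ‖∑ n ∈ Icc 1 N, χ n‖ ≤ √q * (1 + Real.log q) := by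
  have hq0 : (0 : ℝ) < q := by exact_mod_cast (by omega : 0 < q)
  have hτ := norm_gaussSum_of_isPrimitive hχ.inv
  have hsub : ∑ h ∈ range q, χ⁻¹ h * expSum N (h / q) =
      ∑ h ∈ Icc 1 (q - 1), χ⁻¹ h * expSum N (h / q) := by
    symm
    apply sum_subset
    · intro h; simp; omega
    · intro h hh hh'
      simp at hh hh'
      have : h = 0 := by omega
      subst this
      have : χ⁻¹ ((0 : ℕ) : ZMod q) = 0 := by
        rw [Nat.cast_zero]; exact DirichletCharacter.map_zero' χ⁻¹ (by omega)
      rw [this, zero_mul]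
  have hb : ‖∑ h ∈ Icc 1 (q - 1), χ⁻¹ h * expSum N (h / q)‖ ≤ q * (1 + Real.log q) := by
    calc _ ≤ ∑ h ∈ Icc 1 (q - 1), (q / 2 * (1 / (h : ℝ)) + q / 2 * (1 / ((q - h : ℕ) : ℝ))) := by
          refine (norm_sum_le _ _).trans (sum_le_sum fun h hh => ?_)
          have hh := mem_Icc.1 hh
          have h0 : (0 : ℝ) < h := by exact_mod_cast hh.1
          have h1 : (h : ℝ) < q := by exact_mod_cast (by omega : h < q)
          rw [norm_mul]
          have := norm_expSum_le_inv_add_inv (N := N) (θ := h / q) (by positivity)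
            ((div_lt_one hq0).2 h1)
          refine (mul_le_of_le_one_left (norm_nonneg _) (DirichletCharacter.norm_le_one _ _)).trans
            (this.trans (le_of_eq ?_))
          rw [Nat.cast_sub (by omega)]
          have : (q : ℝ) - h ≠ 0 := by linarith
          field_simp
      _ = q / 2 * ∑ h ∈ Icc 1 (q - 1), 1 / (h : ℝ) +
            q / 2 * ∑ h ∈ Icc 1 (q - 1), 1 / ((q - h : ℕ) : ℝ) := by
          rw [sum_add_distrib, mul_sum, mul_sum]
      _ = q * ∑ h ∈ Icc 1 (q - 1), 1 / (h : ℝ) := by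
          have : ∑ h ∈ Icc 1 (q - 1), 1 / ((q - h : ℕ) : ℝ) = ∑ h ∈ Icc 1 (q - 1), 1 / (h : ℝ) := by
            refine sum_bij' (fun h _ => q - h) (fun h _ => q - h) ?_ ?_ ?_ ?_ ?_ <;>
              intro h hh <;> simp only [mem_Icc] at hh ⊢ <;> omega
          rw [this]; ring
      _ ≤ q * (1 + Real.log q) := by
          refine mul_le_mul_of_nonneg_left ((sum_Icc_inv_le _).trans ?_) hq0.le
          have : Real.log ((q - 1 : ℕ) : ℝ) ≤ Real.log q :=
            Real.log_le_log (by exact_mod_cast (by omega : 0 < q - 1)) (by exact_mod_cast Nat.sub_le _ _)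
          linarith
  have h := congrArg norm (sum_apply_of_isPrimitive hχ N)
  rw [norm_mul, hτ, hsub] at h
  rw [← h] at hb
  have hs : 0 < √(q : ℝ) := Real.sqrt_pos.2 hq0
  have h2 : √(q : ℝ) * √q = q := Real.mul_self_sqrt hq0.le
  refine le_of_mul_le_mul_left (hb.trans (le_of_eq ?_)) hs
  rw [← mul_assoc, h2]

end GaussSum

/-- Of `d` and `n / d` one is at most `√n`. For a character of conductor `c` modulo `q = c r`, this
cost `√r` of passing to the primitive character combines with `√c` to give `√q`. -/
theorem card_divisors_le_two_mul_sqrt (n : ℕ) : (n.divisors.card : ℝ) ≤ 2 * √n := by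
  rcases Nat.eq_zero_or_pos n with rfl | hn
  · simp
  have hsub : n.divisors ⊆ Icc 1 n.sqrt ∪ (Icc 1 n.sqrt).image (n / ·) := by
    intro d hd
    have hd' := Nat.dvd_of_mem_divisors hd
    have hd0 := Nat.pos_of_mem_divisors hd
    rw [mem_union, mem_image, mem_Icc]
    by_cases h : d ≤ n.sqrt
    · left; exact ⟨hd0, h⟩
    · right
      refine ⟨n / d, mem_Icc.2 ⟨Nat.div_pos (Nat.le_of_dvd hn hd') hd0, ?_⟩,
        Nat.div_div_self hd' hn.ne'⟩
      push Not at h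
      by_contra h2
      push Not at h2
      have h3 : n / d * d = n := Nat.div_mul_cancel hd'
      have h4 := Nat.lt_succ_sqrt n
      have : (n.sqrt + 1) * (n.sqrt + 1) ≤ n / d * d := Nat.mul_le_mul h2 h
      simp only [Nat.succ_eq_add_one] at h4
      omega
  have h1 : n.divisors.card ≤ 2 * n.sqrt := by
    refine (card_le_card hsub).trans ((card_union_le _ _).trans ?_)
    have := card_image_le (s := Icc 1 n.sqrt) (f := (n / ·))
    simp at this ⊢
    omega
  have h2 : (n.sqrt : ℝ) ≤ √n := Real.nat_sqrt_le_real_sqrt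
  calc (n.divisors.card : ℝ) ≤ ((2 * n.sqrt : ℕ) : ℝ) := by exact_mod_cast h1
    _ ≤ 2 * √n := by push_cast; linarith

theorem sum_divisors_filter_moebius (r n : ℕ) (hr : r ≠ 0) :
    ∑ d ∈ r.divisors with d ∣ n, ArithmeticFunction.moebius d = if n.Coprime r then 1 else 0 := by
  have h : r.divisors.filter (· ∣ n) = (n.gcd r).divisors := by
    ext d
    simp only [mem_filter, Nat.mem_divisors, Nat.dvd_gcd_iff]
    have := Nat.gcd_ne_zero_right (m := n) hr
    tauto
  rw [h, ← ArithmeticFunction.coe_mul_zeta_apply, ArithmeticFunction.moebius_mul_coe_zeta,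
    ArithmeticFunction.one_apply]

theorem sum_Icc_filter_dvd {M : Type*} [AddCommMonoid M] (f : ℕ → M) {d : ℕ} (hd : 0 < d) (N : ℕ) :
    ∑ n ∈ Icc 1 N with d ∣ n, f n = ∑ k ∈ Icc 1 (N / d), f (d * k) := by
  refine sum_nbij' (· / d) (d * ·) ?_ ?_ ?_ ?_ ?_
  · intro n hn
    simp only [mem_filter, mem_Icc] at hn ⊢
    exact ⟨Nat.div_pos (Nat.le_of_dvd (by omega) hn.2) hd, Nat.div_le_div_right hn.1.2⟩
  · intro k hk
    simp only [mem_filter, mem_Icc] at hk ⊢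
    refine ⟨⟨Nat.mul_pos hd hk.1, ?_⟩, dvd_mul_right _ _⟩
    rw [mul_comm]; exact (Nat.le_div_iff_mul_le hd).1 hk.2
  · intro n hn
    exact Nat.mul_div_cancel' (mem_filter.1 hn).2
  · intro k _
    exact Nat.mul_div_cancel_left k hd
  · intro n hn
    show f n = f (d * (n / d))
    rw [Nat.mul_div_cancel' (mem_filter.1 hn).2]

/-- The primitive character already vanishes off the integers coprime to the conductor, so only
coprimality to the cofactor has to be imposed; Möbius inversion can then run over divisors of the
cofactor alone. -/
theorem apply_natCast_eq_ite_primitiveCharacter {q : ℕ} [NeZero q] (χ : DirichletCharacter ℂ q)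
    (n : ℕ) : χ n = if n.Coprime (q / χ.conductor) then χ.primitiveCharacter n else 0 := by
  have hq : χ.conductor * (q / χ.conductor) = q := Nat.mul_div_cancel' χ.conductor_dvd_level
  by_cases h : n.Coprime q
  · rw [if_pos (Nat.Coprime.coprime_dvd_right ⟨_, (mul_comm _ _).trans hq |>.symm⟩ h)]
    have := χ.primitiveCharacter_apply_of_isCoprime (Nat.isCoprime_iff_coprime.2 h)
    simpa using this.symm
  · have h0 : χ n = 0 := by
      have := (DirichletCharacter.apply_eq_zero_iff χ (n : ℤ)).2 (by rwa [Nat.isCoprime_iff_coprime])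
      simpa using this
    rw [h0]
    split_ifs with h1
    · have := (DirichletCharacter.apply_eq_zero_iff χ.primitiveCharacter (n : ℤ)).2 (by
        rw [Nat.isCoprime_iff_coprime]
        intro h2
        exact h (hq ▸ Nat.Coprime.mul_right h2 h1))
      simpa using this.symm
    · rfl

/-- The Pólya–Vinogradov inequality for non-principal characters. -/
theorem norm_sum_le_of_ne_one {q : ℕ} [NeZero q] {χ : DirichletCharacter ℂ q} (hχ : χ ≠ 1) (N : ℕ) :
    ‖∑ n ∈ Icc 1 N, χ n‖ ≤ 2 * √q * (1 + Real.log q) := by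
  set c := χ.conductor with hc
  have hc0 : c ≠ 0 := χ.conductor_ne_zero
  have : NeZero c := ⟨hc0⟩
  have hc1 : 1 < c := by
    have : c ≠ 1 := fun h => hχ (χ.eq_one_iff_conductor_eq_one.2 h)
    omega
  set r := q / c with hr
  have hq : c * r = q := Nat.mul_div_cancel' χ.conductor_dvd_level
  have hq0 : q ≠ 0 := NeZero.ne q
  have hr0 : r ≠ 0 := by rintro h; rw [h, mul_zero] at hq; exact hq0 hq.symm
  set ψ := χ.primitiveCharacter
  have hψ : ψ.IsPrimitive := χ.primitiveCharacter_isPrimitive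
  have hsum : ∑ n ∈ Icc 1 N, χ n =
      ∑ d ∈ r.divisors, (ArithmeticFunction.moebius d : ℂ) * (ψ d * ∑ k ∈ Icc 1 (N / d), ψ k) := by
    calc ∑ n ∈ Icc 1 N, χ n
        = ∑ n ∈ Icc 1 N, ∑ d ∈ r.divisors,
            if d ∣ n then (ArithmeticFunction.moebius d : ℂ) * ψ n else 0 := by
          refine sum_congr rfl fun n _ => ?_
          rw [← sum_filter, ← sum_mul, ← Int.cast_sum, sum_divisors_filter_moebius r n hr0,
            apply_natCast_eq_ite_primitiveCharacter χ n]
          split_ifs <;> simp [ψ]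
      _ = _ := by
          rw [sum_comm]
          refine sum_congr rfl fun d hd => ?_
          rw [← sum_filter, sum_Icc_filter_dvd _ (Nat.pos_of_mem_divisors hd), mul_sum, mul_sum]
          refine sum_congr rfl fun k _ => ?_
          push_cast
          rw [map_mul]
  have hcq : (1 : ℝ) + Real.log c ≤ 1 + Real.log q := by
    have : (c : ℝ) ≤ q := by exact_mod_cast Nat.le_of_dvd (Nat.pos_of_ne_zero hq0) ⟨r, hq.symm⟩
    have := Real.log_le_log (by exact_mod_cast Nat.pos_of_ne_zero hc0) this
    linarith
  have hlog : 0 ≤ 1 + Real.log c := by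
    have := Real.log_natCast_nonneg c
    linarith
  rw [hsum]
  calc _ ≤ ∑ d ∈ r.divisors, √c * (1 + Real.log c) := by
        refine (norm_sum_le _ _).trans (sum_le_sum fun d _ => ?_)
        rw [norm_mul, norm_mul]
        have h1 : ‖(ArithmeticFunction.moebius d : ℂ)‖ ≤ 1 := by
          rw [Complex.norm_intCast]
          exact_mod_cast ArithmeticFunction.abs_moebius_le_one
        refine (mul_le_of_le_one_left (by positivity) h1).trans ?_
        refine (mul_le_of_le_one_left (norm_nonneg _) (DirichletCharacter.norm_le_one _ _)).trans ?_
        exact norm_sum_le_of_isPrimitive hc1 hψ _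
    _ = r.divisors.card * (√c * (1 + Real.log c)) := by rw [sum_const, nsmul_eq_mul]
    _ ≤ 2 * √r * (√c * (1 + Real.log c)) :=
        mul_le_mul_of_nonneg_right (card_divisors_le_two_mul_sqrt r) (by positivity)
    _ = 2 * √q * (1 + Real.log c) := by
        rw [← hq]; push_cast; rw [Real.sqrt_mul (by positivity)]; ring
    _ ≤ _ := by gcongr

/-! ### The Jacobi symbol as a character in its lower argument. -/

/-- The Jacobi symbol `J(n | ·)` on odd moduli, as a Dirichlet character modulo `4 * n`. -/
noncomputable def jacobiChar (n : ℕ) [NeZero n] : DirichletCharacter ℂ (4 * n) where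
  toFun x := if Odd x.val then (J(n | x.val) : ℂ) else 0
  map_one' := by
    have : Fact (1 < 4 * n) := ⟨by have := NeZero.pos n; omega⟩
    simp [ZMod.val_one]
  map_mul' x y := by
    have h : Odd (x * y).val ↔ Odd x.val ∧ Odd y.val := by
      rw [ZMod.val_mul, ← Nat.odd_mul]
      simp only [Nat.odd_iff]
      rw [Nat.mod_mod_of_dvd _ (by omega)]
    by_cases hx : Odd x.val <;> by_cases hy : Odd y.val <;> simp only [h, hx, hy, if_true, if_false,
      and_true, and_false, mul_zero, zero_mul]
    have : NeZero x.val := ⟨by rintro h; simp [h] at hx⟩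
    have : NeZero y.val := ⟨by rintro h; simp [h] at hy⟩
    -- Periodicity modulo `4 * n` of the symbol on odd moduli is quadratic reciprocity in disguise.
    rw [ZMod.val_mul, ← jacobiSym.mod_right' n (hx.mul hy), jacobiSym.mul_right]
    push_cast; rfl
  map_nonunit' x hx := by
    split_ifs with h
    · have : NeZero x.val := ⟨by rintro h'; simp [h'] at h⟩
      rw [jacobiSym.eq_zero_iff_not_coprime.2, Int.cast_zero]
      intro hc
      rw [Int.gcd_natCast_natCast] at hc
      apply hx
      have : ((x.val : ℕ) : ZMod (4 * n)) = x := ZMod.natCast_zmod_val x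
      rw [← this, ZMod.isUnit_iff_coprime]
      refine Nat.Coprime.mul_right ?_ (Nat.coprime_comm.1 hc)
      have : Nat.Coprime x.val (2 ^ 2) := Nat.Coprime.pow_right 2 (Nat.coprime_two_right.2 h)
      exact this
    · rfl

theorem jacobiChar_natCast (n : ℕ) [NeZero n] (m : ℕ) :
    jacobiChar n (m : ZMod (4 * n)) = if Odd m then (J(n | m) : ℂ) else 0 := by
  show (if Odd (m : ZMod (4 * n)).val then (J(n | (m : ZMod (4 * n)).val) : ℂ) else 0) = _
  have h : Odd (m % (4 * n)) ↔ Odd m := by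
    simp only [Nat.odd_iff]
    rw [Nat.mod_mod_of_dvd _ (by omega)]
  simp only [ZMod.val_natCast, h]
  split_ifs with hm
  · rw [← jacobiSym.mod_right' n hm]
  · rfl

theorem exists_odd_multiplicity_of_not_isSquare {n : ℕ} (hn : n ≠ 0) (h : ¬ IsSquare n) :
    ∃ q k r : ℕ, q.Prime ∧ n = q ^ (2 * k + 1) * r ∧ ¬ q ∣ r := by
  obtain ⟨a, b, hab, ha⟩ := Nat.sq_mul_squarefree n
  have ha1 : a ≠ 1 := by
    rintro rfl
    exact h ⟨b, by rw [← hab]; ring⟩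
  obtain ⟨q, hq, hqa⟩ := Nat.exists_prime_and_dvd ha1
  obtain ⟨e, r, hr, hne⟩ := Nat.exists_eq_pow_mul_and_not_dvd hn q hq.ne_one
  obtain ⟨a', rfl⟩ := hqa
  have hb0 : b ≠ 0 := by rintro rfl; simp at hab; exact hn hab.symm
  obtain ⟨f, s, hs, hse⟩ := Nat.exists_eq_pow_mul_and_not_dvd hb0 q hq.ne_one
  have hqa' : ¬ q ∣ a' := fun ⟨t, ht⟩ => by
    have := ha q ⟨t, by rw [ht]; ring⟩
    exact hq.one_lt.ne' (Nat.isUnit_iff.1 this)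
  refine ⟨q, f, s ^ 2 * a', hq, ?_, ?_⟩
  · rw [← hab, hse]; ring
  · intro hd
    rcases (hq.dvd_mul).1 hd with h1 | h1
    · exact hs (hq.dvd_of_dvd_pow h1)
    · exact hqa' h1

/-- Some prime `q` divides `n` to an odd power; let `r` be the part of `n` prime to `q`. The Chinese
remainder theorem gives `m` with `J(q | m) = -1` and `J(r | m) = 1`: if `q = 2`, take `m ≡ 5` modulo
8 and `m ≡ 1` modulo `r`; if `q` is odd, take `m ≡ 1` modulo `4r` and `m` a non-residue modulo `q`.
-/
theorem exists_odd_jacobiSym_eq_neg_one {n : ℕ} (hn : n ≠ 0) (h : ¬ IsSquare n) :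
    ∃ m : ℕ, Odd m ∧ J(n | m) = -1 := by
  obtain ⟨q, k, r, hq, rfl, hqr⟩ := exists_odd_multiplicity_of_not_isSquare hn h
  suffices hm : ∃ m : ℕ, Odd m ∧ J(q | m) = -1 ∧ J(r | m) = 1 by
    obtain ⟨m, hm, h1, h2⟩ := hm
    refine ⟨m, hm, ?_⟩
    push_cast
    rw [jacobiSym.mul_left, jacobiSym.pow_left, h1, h2, mul_one]
    exact Odd.neg_one_pow ⟨k, rfl⟩
  rcases hq.eq_two_or_odd' with rfl | hodd
  · have hr : Odd r := Nat.odd_iff.2 (by omega)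
    have hc : Nat.Coprime 8 r := by
      have : Nat.Coprime (2 ^ 3) r := Nat.Coprime.pow_left 3 (Nat.coprime_two_left.2 hr)
      exact this
    obtain ⟨m, hm8, hmr⟩ := Nat.chineseRemainder hc 5 1
    have hm8' : m % 8 = 5 := hm8
    have hmo : Odd m := Nat.odd_iff.2 (by omega)
    refine ⟨m, hmo, ?_, ?_⟩
    · have := jacobiSym.at_two hmo
      push_cast
      rw [this, ZMod.χ₈_nat_eq_if_mod_eight]
      rw [if_neg (by omega), if_neg (by omega)]
    · rw [← jacobiSym.quadratic_reciprocity_one_mod_four (by omega) hr]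
      have : J((m : ℤ) | r) = J((1 : ℤ) | r) := jacobiSym.mod_left' (by exact_mod_cast hmr)
      rw [this, jacobiSym.one_left]
  · have : Fact q.Prime := ⟨hq⟩
    have hq2 : ringChar (ZMod q) ≠ 2 := by
      rw [ZMod.ringChar_zmod_n]; rintro rfl; exact absurd hodd (by decide)
    obtain ⟨u, hu⟩ := FiniteField.exists_nonsquare hq2
    have hc : Nat.Coprime (4 * r) q := by
      rw [Nat.coprime_comm]
      refine Nat.Coprime.mul_right ?_ ((Nat.Prime.coprime_iff_not_dvd hq).2 hqr)
      have : Nat.Coprime q (2 ^ 2) := Nat.Coprime.pow_right 2 (Nat.coprime_two_right.2 hodd)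
      exact this
    obtain ⟨m, hm4, hmq⟩ := Nat.chineseRemainder hc 1 u.val
    have hm4' : m % 4 = 1 := (hm4.of_mul_right r : m ≡ 1 [MOD 4])
    have hmo : Odd m := Nat.odd_iff.2 (by omega)
    refine ⟨m, hmo, ?_, ?_⟩
    · rw [← jacobiSym.quadratic_reciprocity_one_mod_four hm4' hodd]
      refine (ZMod.nonsquare_iff_jacobiSym_eq_neg_one (p := q)).2 ?_
      have : ((m : ℤ) : ZMod q) = u := by
        have h1 := (ZMod.natCast_eq_natCast_iff _ _ _).2 hmq
        rw [ZMod.natCast_zmod_val] at h1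
        exact_mod_cast h1
      rwa [this]
    · have h1 := jacobiSym.mod_right' r hmo
      have h2 : m % (4 * r) = 1 % (4 * r) := hm4
      have hr0 : r ≠ 0 := by rintro rfl; simp at hn
      rw [Nat.mod_eq_of_lt (by omega : 1 < 4 * r)] at h2
      rw [h1, h2, jacobiSym.one_right]

theorem jacobiChar_ne_one {n : ℕ} [NeZero n] (h : ¬ IsSquare n) : jacobiChar n ≠ 1 := by
  intro hχ
  obtain ⟨m, hm, hJ⟩ := exists_odd_jacobiSym_eq_neg_one (NeZero.ne n) h
  have h1 := jacobiChar_natCast n m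
  rw [if_pos hm, hJ, hχ] at h1
  by_cases hu : IsUnit ((m : ℕ) : ZMod (4 * n))
  · rw [MulChar.one_apply hu] at h1; norm_num at h1
  · rw [MulChar.map_nonunit _ hu] at h1; norm_num at h1

/-- `J(h | m)` for odd `m`, and zero for even `m`. -/
noncomputable def oddJacobi (h m : ℕ) : ℝ := if Odd m then (J(h | m) : ℝ) else 0

theorem oddJacobi_mul (a b m : ℕ) : oddJacobi a m * oddJacobi b m = oddJacobi (a * b) m := by
  unfold oddJacobi
  split_ifs
  · push_cast; rw [jacobiSym.mul_left]; push_cast; rfl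
  · simp

theorem abs_oddJacobi_le_one (a m : ℕ) : |oddJacobi a m| ≤ 1 := by
  unfold oddJacobi
  split_ifs
  · rcases jacobiSym.trichotomy a m with h | h | h <;> rw [h] <;> simp
  · simp

/-- The Pólya–Vinogradov inequality for the Jacobi symbol of a non-square. -/
theorem abs_sum_oddJacobi_le {n : ℕ} (hn : n ≠ 0) (h : ¬ IsSquare n) (N : ℕ) :
    |∑ m ∈ Icc 1 N, oddJacobi n m| ≤ 4 * √n * (1 + Real.log (4 * n)) := by
  have : NeZero n := ⟨hn⟩
  have := norm_sum_le_of_ne_one (jacobiChar_ne_one h) N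
  have e : ∑ m ∈ Icc 1 N, jacobiChar n m = ((∑ m ∈ Icc 1 N, oddJacobi n m : ℝ) : ℂ) := by
    push_cast
    refine sum_congr rfl fun m _ => ?_
    rw [jacobiChar_natCast, oddJacobi]
    split_ifs <;> simp
  rw [e, Complex.norm_real, Real.norm_eq_abs] at this
  refine this.trans (le_of_eq ?_)
  push_cast
  rw [Real.sqrt_mul (by norm_num), show (4 : ℝ) = 2 ^ 2 by norm_num, Real.sqrt_sq (by norm_num)]
  ring

/-! ### Pairs whose product is a square. -/

/-- The two bounds cross at `U = √(Z / Y)`; the head contributes at most `U Y` and the tail at most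
`2 Z / U`, and `U Y = Z / U = √(Y Z)`. -/
theorem sum_Icc_min_div_sq_le {Y Z : ℝ} (hY : 0 ≤ Y) (hZ : 0 ≤ Z) (M : ℕ) :
    ∑ u ∈ Icc 1 M, min Y (Z / (u : ℝ) ^ 2) ≤ 3 * √(Y * Z) := by
  rcases hY.eq_or_lt with rfl | hY
  · have : ∑ u ∈ Icc 1 M, min 0 (Z / (u : ℝ) ^ 2) ≤ 0 := sum_nonpos fun u _ => min_le_left _ _
    simpa using this
  rcases hZ.eq_or_lt with rfl | hZ
  · have : ∑ u ∈ Icc 1 M, min Y (0 / (u : ℝ) ^ 2) ≤ 0 :=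
      sum_nonpos fun u _ => (min_le_right _ _).trans (by simp)
    simpa using this
  set U := √(Z / Y) with hU
  have hU0 : 0 < U := Real.sqrt_pos.2 (by positivity)
  have hUY : U * Y = √(Y * Z) := by
    rw [eq_comm, Real.sqrt_eq_iff_mul_self_eq (by positivity) (by positivity)]
    have : U * U = Z / Y := Real.mul_self_sqrt (by positivity)
    symm
    calc U * Y * (U * Y) = (U * U) * Y * Y := by ring
      _ = Y * Z := by rw [this]; field_simp
  have hZU : Z / U = √(Y * Z) := by
    rw [← hUY, div_eq_iff hU0.ne']
    have : U * U = Z / Y := Real.mul_self_sqrt (by positivity)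
    calc Z = (Z / Y) * Y := by field_simp
      _ = U * Y * U := by rw [← this]; ring
  set k := ⌊U⌋₊ with hk
  have hsub : Icc 1 M ⊆ Icc 1 k ∪ Ioo k (M + 1) := by
    intro u; simp only [mem_union, mem_Icc, mem_Ioo]; omega
  have hnn : ∀ u : ℕ, 0 ≤ min Y (Z / (u : ℝ) ^ 2) := fun u => le_min hY.le (by positivity)
  calc ∑ u ∈ Icc 1 M, min Y (Z / (u : ℝ) ^ 2)
      ≤ ∑ u ∈ Icc 1 k ∪ Ioo k (M + 1), min Y (Z / (u : ℝ) ^ 2) :=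
        sum_le_sum_of_subset_of_nonneg hsub fun u _ _ => hnn u
    _ ≤ ∑ u ∈ Icc 1 k, min Y (Z / (u : ℝ) ^ 2) + ∑ u ∈ Ioo k (M + 1), min Y (Z / (u : ℝ) ^ 2) := by
        have := sum_union_inter (s₁ := Icc 1 k) (s₂ := Ioo k (M + 1))
          (f := fun u : ℕ => min Y (Z / (u : ℝ) ^ 2))
        have h2 : 0 ≤ ∑ u ∈ Icc 1 k ∩ Ioo k (M + 1), min Y (Z / (u : ℝ) ^ 2) :=
          sum_nonneg fun u _ => hnn u
        linarith
    _ ≤ ∑ u ∈ Icc 1 k, Y + ∑ u ∈ Ioo k (M + 1), Z * ((u : ℝ) ^ 2)⁻¹ := by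
        refine add_le_add (sum_le_sum fun u _ => min_le_left _ _)
          (sum_le_sum fun u _ => (min_le_right _ _).trans (le_of_eq (div_eq_mul_inv _ _)))
    _ ≤ U * Y + Z * (2 / U) := by
        rw [← mul_sum, sum_const, Nat.card_Icc, nsmul_eq_mul, Nat.add_sub_cancel]
        refine add_le_add (mul_le_mul_of_nonneg_right (Nat.floor_le hU0.le) hY.le)
          (mul_le_mul_of_nonneg_left ((sum_Ioo_inv_sq_le k (M + 1)).trans ?_) hZ.le)
        exact div_le_div_of_nonneg_left (by norm_num) hU0 (Nat.lt_floor_add_one U).le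
    _ = 3 * √(Y * Z) := by
        have : Z * (2 / U) = 2 * (Z / U) := by ring
        rw [this, hUY, hZU]; ring

theorem eq_of_squarefree_of_isSquare_mul {a b : ℕ} (ha : Squarefree a) (hb : Squarefree b)
    (h : IsSquare (a * b)) : a = b := by
  obtain ⟨w, hw⟩ := h
  have ha0 : a ≠ 0 := ha.ne_zero
  have haw : a ∣ w := by
    rw [← ha.dvd_pow_iff_dvd two_ne_zero, sq, ← hw]
    exact dvd_mul_right _ _
  obtain ⟨t, rfl⟩ := haw
  have hb' : b = a * (t * t) := by
    apply Nat.eq_of_mul_eq_mul_left (Nat.pos_of_ne_zero ha0)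
    rw [hw]; ring
  have ht : IsUnit t := hb t ⟨a, by rw [hb']; ring⟩
  rw [Nat.isUnit_iff] at ht
  rw [hb', ht]; ring

theorem isSquare_of_isSquare_mul_sq {a b : ℕ} (hb : b ≠ 0) (h : IsSquare (a * b ^ 2)) :
    IsSquare a := by
  obtain ⟨w, hw⟩ := h
  have hbw : b ∣ w := by
    rw [← Nat.pow_dvd_pow_iff two_ne_zero, sq w, ← hw]
    exact dvd_mul_left _ _
  obtain ⟨t, rfl⟩ := hbw
  refine ⟨t, ?_⟩
  apply Nat.eq_of_mul_eq_mul_right (Nat.pos_of_ne_zero (pow_ne_zero 2 hb))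
  rw [hw]; ring

/-- Pairs whose product is a square contribute little more than the diagonal. -/
theorem sum_isSquare_mul_le {S : Finset ℕ} {H : ℕ} (hS : S ⊆ Icc 1 H) {f : ℕ → ℝ} {Y Z : ℝ}
    (hf : ∀ h ∈ S, 0 ≤ f h) (hY : 0 ≤ Y) (hZ : 0 ≤ Z) (hfY : ∀ h ∈ S, f h ≤ Y)
    (hfZ : ∀ h ∈ S, f h ≤ Z / h) :
    ∑ h ∈ S, ∑ k ∈ S with IsSquare (h * k), f h * f k ≤ 9 * Y * Z * (1 + Real.log H) := by
  -- With `h = u² g` and `g` squarefree, a square product `hk` forces equal `g`, so the pairs are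
  -- grouped by `g`.
  have hex : ∀ h : ℕ, ∃ g u : ℕ, u ^ 2 * g = h ∧ Squarefree g := fun h => by
    obtain ⟨g, u, h1, h2⟩ := Nat.sq_mul_squarefree h
    exact ⟨g, u, h1, h2⟩
  choose g u hgu hg using hex
  have hS1 : ∀ h ∈ S, 1 ≤ h ∧ h ≤ H := fun h hh => mem_Icc.1 (hS hh)
  have hu0 : ∀ h ∈ S, u h ≠ 0 := fun h hh h0 => by
    have := hgu h; rw [h0] at this; have := hS1 h hh; simp at *; omega
  have hgm : ∀ h ∈ S, g h ∈ Icc 1 H := fun h hh => by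
    have h1 := hg h
    have h2 := hS1 h hh
    have h3 : g h ∣ h := ⟨u h ^ 2, by rw [mul_comm]; exact (hgu h).symm⟩
    exact mem_Icc.2 ⟨Nat.pos_of_ne_zero h1.ne_zero, (Nat.le_of_dvd h2.1 h3).trans h2.2⟩
  have hum : ∀ h ∈ S, u h ∈ Icc 1 H := fun h hh => by
    have h2 := hS1 h hh
    have h3 : u h ∣ h := ⟨u h * g h, by rw [← mul_assoc, ← sq]; exact (hgu h).symm⟩
    exact mem_Icc.2 ⟨Nat.pos_of_ne_zero (hu0 h hh), (Nat.le_of_dvd h2.1 h3).trans h2.2⟩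
  have hkey : ∀ h ∈ S, ∀ k ∈ S, IsSquare (h * k) → g h = g k := by
    intro h hh k hk hsq
    refine eq_of_squarefree_of_isSquare_mul (hg h) (hg k) ?_
    refine isSquare_of_isSquare_mul_sq (b := u h * u k) (mul_ne_zero (hu0 h hh) (hu0 k hk)) ?_
    have : g h * g k * (u h * u k) ^ 2 = h * k := by
      conv_rhs => rw [← hgu h, ← hgu k]
      ring
    rwa [this]
  -- On a fibre `h = u² a`, the two bounds on `f` become `min(Y, (Z / a) / u²)`. The squared fibre
  -- sum is `O(Y Z / a)`, and summing over `a` costs one logarithm.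
  have hfib : ∀ a ∈ Icc 1 H, ∑ h ∈ S with g h = a, f h ≤ 3 * √(Y * (Z / a)) := by
    intro a ha
    refine le_trans ?_ (sum_Icc_min_div_sq_le hY (by positivity : 0 ≤ Z / (a : ℝ)) H)
    have hinj : Set.InjOn u (S.filter (fun h => g h = a)) := by
      intro h hh k hk hhk
      simp only [coe_filter, Set.mem_ofPred_eq] at hh hk
      rw [← hgu h, ← hgu k, hhk, hh.2, hk.2]
    calc ∑ h ∈ S with g h = a, f h
        ≤ ∑ h ∈ S with g h = a, min Y (Z / a / (u h : ℝ) ^ 2) := by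
          refine sum_le_sum fun h hh => ?_
          obtain ⟨hhS, hga⟩ := mem_filter.1 hh
          refine le_min (hfY h hhS) ((hfZ h hhS).trans (le_of_eq ?_))
          rw [div_div, ← hga]
          congr 1
          have := hgu h
          rw [mul_comm] at this
          exact_mod_cast this.symm
      _ = ∑ v ∈ (S.filter (fun h => g h = a)).image u, min Y (Z / a / (v : ℝ) ^ 2) := by
          rw [sum_image hinj]
      _ ≤ _ := by
          refine sum_le_sum_of_subset_of_nonneg ?_ fun v _ _ => le_min hY (by positivity)
          intro v hv
          obtain ⟨h, hh, rfl⟩ := mem_image.1 hv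
          exact hum h (mem_filter.1 hh).1
  calc ∑ h ∈ S, ∑ k ∈ S with IsSquare (h * k), f h * f k
      ≤ ∑ h ∈ S, ∑ k ∈ S with g k = g h, f h * f k := by
        refine sum_le_sum fun h hh => ?_
        refine sum_le_sum_of_subset_of_nonneg ?_ fun k hk _ =>
          mul_nonneg (hf h hh) (hf k (mem_filter.1 hk).1)
        intro k hk
        obtain ⟨hk, hsq⟩ := mem_filter.1 hk
        exact mem_filter.2 ⟨hk, (hkey h hh k hk hsq).symm⟩
    _ = ∑ a ∈ Icc 1 H, (∑ h ∈ S with g h = a, f h) ^ 2 := by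
        rw [← sum_fiberwise_of_maps_to hgm]
        refine sum_congr rfl fun a _ => ?_
        rw [sq, sum_mul]
        refine sum_congr rfl fun h hh => ?_
        rw [(mem_filter.1 hh).2, mul_sum]
    _ ≤ ∑ a ∈ Icc 1 H, 9 * Y * Z * (1 / (a : ℝ)) := by
        refine sum_le_sum fun a ha => ?_
        have h0 : 0 ≤ ∑ h ∈ S with g h = a, f h := sum_nonneg fun h hh => hf h (mem_filter.1 hh).1
        calc _ ≤ (3 * √(Y * (Z / a))) ^ 2 := pow_le_pow_left₀ h0 (hfib a ha) 2
          _ = _ := by rw [mul_pow, Real.sq_sqrt (by positivity)]; ring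
    _ ≤ _ := by
        rw [← mul_sum]
        exact mul_le_mul_of_nonneg_left (sum_Icc_inv_le H) (by positivity)

/-! ### Partial summation and the general mean square inequality. -/

theorem sum_Ioc_mul_eq_by_parts (g : ℕ → ℂ) (u : ℕ → ℝ) {X Y : ℕ} (hXY : X ≤ Y) :
    ∑ m ∈ Ioc X Y, g m * u m = g Y * (∑ m ∈ Ioc X Y, u m : ℝ) -
      ∑ m ∈ Ico X Y, (g (m + 1) - g m) * (∑ k ∈ Ioc X m, u k : ℝ) := by
  induction Y, hXY using Nat.le_induction with
  | base => simp
  | succ Y hXY ih =>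
    rw [sum_Ioc_succ_top hXY, sum_Ioc_succ_top hXY, ih, sum_Ico_succ_top hXY]
    push_cast
    ring

/-- Summation by parts; the 2 arises because a sum over `(X, m]` is a difference of two initial
sums. -/
theorem norm_sum_Ioc_mul_le (g : ℕ → ℂ) (u : ℕ → ℝ) {X Y : ℕ} (hXY : X < Y) {P B V : ℝ}
    (hP : ∀ N, |∑ m ∈ Icc 1 N, u m| ≤ P) (hB : ‖g Y‖ ≤ B)
    (hV : ∑ m ∈ Ioo X Y, ‖g (m + 1) - g m‖ ≤ V) :
    ‖∑ m ∈ Ioc X Y, g m * u m‖ ≤ 2 * P * (B + V) := by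
  have hU : ∀ m, X ≤ m → |∑ k ∈ Ioc X m, u k| ≤ 2 * P := by
    intro m hm
    have h : ∑ k ∈ Icc 1 m, u k = ∑ k ∈ Icc 1 X, u k + ∑ k ∈ Ioc X m, u k := by
      rw [← sum_union]
      · congr 1; ext k; simp only [mem_Icc, mem_union, mem_Ioc]; omega
      · rw [disjoint_left]; intro k; simp only [mem_Icc, mem_Ioc]; omega
    have h1 := abs_le.1 (hP m)
    have h2 := abs_le.1 (hP X)
    rw [abs_le]; constructor <;> linarith
  have hP0 : 0 ≤ P := (abs_nonneg _).trans (hP 0)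
  rw [sum_Ioc_mul_eq_by_parts g u hXY.le]
  -- The term `m = X` has an empty inner sum, so `g X` is never used: coefficients need control only
  -- on `(X, Y]`.
  have hIco : ∑ m ∈ Ico X Y, (g (m + 1) - g m) * ((∑ k ∈ Ioc X m, u k : ℝ) : ℂ) =
      ∑ m ∈ Ioo X Y, (g (m + 1) - g m) * ((∑ k ∈ Ioc X m, u k : ℝ) : ℂ) := by
    symm
    refine sum_subset Ioo_subset_Ico_self fun m hm hm' => ?_
    have : m = X := by simp only [mem_Ico, mem_Ioo] at hm hm'; omega
    subst this
    simp
  rw [hIco]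
  calc _ ≤ ‖g Y * ((∑ m ∈ Ioc X Y, u m : ℝ) : ℂ)‖ +
        ‖∑ m ∈ Ioo X Y, (g (m + 1) - g m) * ((∑ k ∈ Ioc X m, u k : ℝ) : ℂ)‖ := norm_sub_le _ _
    _ ≤ B * (2 * P) + ∑ m ∈ Ioo X Y, ‖g (m + 1) - g m‖ * (2 * P) := by
        gcongr
        · rw [norm_mul, Complex.norm_real]
          exact mul_le_mul hB (hU Y hXY.le) (norm_nonneg _) ((norm_nonneg _).trans hB)
        · refine (norm_sum_le _ _).trans (sum_le_sum fun m hm => ?_)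
          rw [norm_mul, Complex.norm_real]
          exact mul_le_mul_of_nonneg_left (hU m (mem_Ioo.1 hm).1.le) (norm_nonneg _)
    _ ≤ B * (2 * P) + V * (2 * P) := by
        rw [← sum_mul]
        gcongr
    _ = _ := by ring

theorem norm_mul_conj_sub_mul_conj_le {a a' b b' : ℂ} {A B : ℝ} (ha : ‖a'‖ ≤ A) (hb : ‖b‖ ≤ B) :
    ‖a' * (starRingEnd ℂ) b' - a * (starRingEnd ℂ) b‖ ≤ A * ‖b' - b‖ + ‖a' - a‖ * B := by
  have : a' * (starRingEnd ℂ) b' - a * (starRingEnd ℂ) b =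
      a' * (starRingEnd ℂ) (b' - b) + (a' - a) * (starRingEnd ℂ) b := by
    rw [map_sub]; ring
  rw [this]
  refine (norm_add_le _ _).trans ?_
  rw [norm_mul, norm_mul, RCLike.norm_conj, RCLike.norm_conj]
  gcongr

/-- A mean square estimate for quadratic characters with coefficients of bounded variation in the
modulus. -/
theorem sum_norm_sq_oddJacobi_le {S : Finset ℕ} {H X : ℕ} (hS : S ⊆ Icc 1 H) (hX : 0 < X)
    {c : ℕ → ℕ → ℂ} {E W : ℕ → ℝ} (hE : ∀ h ∈ S, ∀ m ∈ Ioc X (2 * X), ‖c h m‖ ≤ E h)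
    (hW : ∀ h ∈ S, ∑ m ∈ Ioo X (2 * X), ‖c h (m + 1) - c h m‖ ≤ W h) :
    ∑ m ∈ Ioc X (2 * X), ‖∑ h ∈ S, c h m * oddJacobi h m‖ ^ 2 ≤
      X * ∑ h ∈ S, ∑ k ∈ S with IsSquare (h * k), E h * E k +
      8 * (1 + Real.log (4 * H ^ 2)) * ((∑ h ∈ S, √h * E h) ^ 2 +
        2 * (∑ h ∈ S, √h * E h) * ∑ h ∈ S, √h * W h) := by
  have h2X : 2 * X ∈ Ioc X (2 * X) := mem_Ioc.2 ⟨by omega, le_rfl⟩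
  have hE0 : ∀ h ∈ S, 0 ≤ E h := fun h hh => (norm_nonneg _).trans (hE h hh _ h2X)
  have hW0 : ∀ h ∈ S, 0 ≤ W h := fun h hh => (sum_nonneg fun _ _ => norm_nonneg _).trans (hW h hh)
  set L := 1 + Real.log (4 * H ^ 2) with hL
  set T : ℕ → ℕ → ℂ := fun h k => ∑ m ∈ Ioc X (2 * X),
    (c h m * (starRingEnd ℂ) (c k m)) * (oddJacobi (h * k) m : ℝ) with hT
  have hexp : ((∑ m ∈ Ioc X (2 * X), ‖∑ h ∈ S, c h m * oddJacobi h m‖ ^ 2 : ℝ) : ℂ) =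
      ∑ h ∈ S, ∑ k ∈ S, T h k := by
    push_cast
    have h1 : ∀ m, ((‖∑ h ∈ S, c h m * (oddJacobi h m : ℂ)‖ : ℂ)) ^ 2 = ∑ h ∈ S, ∑ k ∈ S,
        (c h m * (starRingEnd ℂ) (c k m)) * (oddJacobi (h * k) m : ℝ) := by
      intro m
      rw [← Complex.mul_conj', map_sum, sum_mul_sum]
      refine sum_congr rfl fun h _ => sum_congr rfl fun k _ => ?_
      rw [← oddJacobi_mul, map_mul, Complex.conj_ofReal]
      push_cast
      ring
    simp_rw [h1, hT]
    rw [sum_comm]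
    refine sum_congr rfl fun h _ => ?_
    rw [sum_comm]
  have hle : ∑ m ∈ Ioc X (2 * X), ‖∑ h ∈ S, c h m * oddJacobi h m‖ ^ 2 ≤
      ∑ h ∈ S, ∑ k ∈ S, ‖T h k‖ := by
    have h0 : 0 ≤ ∑ m ∈ Ioc X (2 * X), ‖∑ h ∈ S, c h m * oddJacobi h m‖ ^ 2 :=
      sum_nonneg fun _ _ => by positivity
    rw [← abs_of_nonneg h0, ← Real.norm_eq_abs, ← Complex.norm_real, hexp]
    exact (norm_sum_le _ _).trans (sum_le_sum fun h _ => norm_sum_le _ _)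
  have hsq : ∀ h ∈ S, ∀ k ∈ S, ‖T h k‖ ≤ X * (E h * E k) := by
    intro h hh k hk
    refine (norm_sum_le _ _).trans ?_
    calc _ ≤ ∑ m ∈ Ioc X (2 * X), E h * E k := by
          refine sum_le_sum fun m hm => ?_
          rw [norm_mul, norm_mul, RCLike.norm_conj, Complex.norm_real]
          have h1 := mul_le_mul (hE h hh m hm) (hE k hk m hm) (norm_nonneg _) (hE0 h hh)
          exact (mul_le_of_le_one_right (by positivity) (abs_oddJacobi_le_one _ _)).trans h1
      _ = _ := by
          rw [sum_const, Nat.card_Ioc, nsmul_eq_mul]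
          congr 2; omega
  -- The Pólya–Vinogradov bound for the modulus `4hk` has size `√h √k` up to a logarithm, so it
  -- separates in `h` and `k`.
  have hnsq : ∀ h ∈ S, ∀ k ∈ S, ¬ IsSquare (h * k) →
      ‖T h k‖ ≤ 8 * L * ((√h * E h) * (√k * E k) + (√h * E h) * (√k * W k) +
        (√h * W h) * (√k * E k)) := by
    intro h hh k hk hns
    have h1 := mem_Icc.1 (hS hh)
    have k1 := mem_Icc.1 (hS hk)
    have hPV : ∀ N, |∑ m ∈ Icc 1 N, oddJacobi (h * k) m| ≤ 4 * (√h * √k) * L := by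
      intro N
      refine (abs_sum_oddJacobi_le (Nat.mul_ne_zero (by omega) (by omega)) hns N).trans ?_
      rw [Nat.cast_mul, Real.sqrt_mul (by positivity)]
      refine mul_le_mul_of_nonneg_left ?_ (by positivity)
      have hpos : (0 : ℝ) < 4 * ((h : ℝ) * k) := by
        have : (0 : ℝ) < h := by exact_mod_cast h1.1
        have : (0 : ℝ) < k := by exact_mod_cast k1.1
        positivity
      have : 4 * ((h : ℝ) * k) ≤ 4 * (H : ℝ) ^ 2 := by
        rw [sq]
        have : (h : ℝ) ≤ H := by exact_mod_cast h1.2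
        have : (k : ℝ) ≤ H := by exact_mod_cast k1.2
        gcongr
      have := Real.log_le_log hpos this
      linarith
    have hmain := norm_sum_Ioc_mul_le (fun m => c h m * (starRingEnd ℂ) (c k m))
      (fun m => oddJacobi (h * k) m) (by omega : X < 2 * X) (P := 4 * (√h * √k) * L)
      (B := E h * E k) (V := E h * W k + W h * E k) hPV
      (by
        rw [norm_mul, RCLike.norm_conj]
        exact mul_le_mul (hE h hh _ h2X) (hE k hk _ h2X) (norm_nonneg _) (hE0 h hh))
      (by
        calc _ ≤ ∑ m ∈ Ioo X (2 * X), (E h * ‖c k (m + 1) - c k m‖ + ‖c h (m + 1) - c h m‖ * E k) := by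
              refine sum_le_sum fun m hm => ?_
              have hm := mem_Ioo.1 hm
              exact norm_mul_conj_sub_mul_conj_le (hE h hh _ (mem_Ioc.2 ⟨by omega, by omega⟩))
                (hE k hk _ (mem_Ioc.2 ⟨by omega, by omega⟩))
          _ ≤ _ := by
              rw [sum_add_distrib, ← mul_sum, ← sum_mul]
              exact add_le_add (mul_le_mul_of_nonneg_left (hW k hk) (hE0 h hh))
                (mul_le_mul_of_nonneg_right (hW h hh) (hE0 k hk)))
    refine hmain.trans (le_of_eq ?_)
    ring
  have hL0 : 0 ≤ L := by
    have := Real.log_natCast_nonneg (4 * H ^ 2)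
    push_cast at this
    linarith
  refine hle.trans ?_
  -- The non-negative off-diagonal bound is added for square pairs too, so that the double sum
  -- factors into products of single sums.
  calc ∑ h ∈ S, ∑ k ∈ S, ‖T h k‖
      ≤ ∑ h ∈ S, ∑ k ∈ S, ((if IsSquare (h * k) then X * (E h * E k) else 0) +
          8 * L * ((√h * E h) * (√k * E k) + (√h * E h) * (√k * W k) +
            (√h * W h) * (√k * E k))) := by
        refine sum_le_sum fun h hh => sum_le_sum fun k hk => ?_
        have := hE0 h hh
        have := hE0 k hk
        have := hW0 h hh
        have := hW0 k hk
        split_ifs with hs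
        · have := hsq h hh k hk
          have : 0 ≤ 8 * L * ((√h * E h) * (√k * E k) + (√h * E h) * (√k * W k) +
            (√h * W h) * (√k * E k)) := by positivity
          linarith
        · rw [zero_add]; exact hnsq h hh k hk hs
    _ = _ := by
        simp_rw [sum_add_distrib, ← sum_filter, ← mul_sum, sum_add_distrib, ← mul_sum, ← sum_mul]
        ring

/-- The engine with coefficients 1; the diagonal uses `1 ≤ L / a`. Only the size and the upper limit
of `A` matter, so short intervals far from the origin are allowed. -/
theorem sum_sq_oddJacobi_finset_le {A : Finset ℕ} {L K X : ℕ} (hA : A ⊆ Icc 1 L) (hK : #A ≤ K)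
    (hX : 0 < X) :
    ∑ m ∈ Ioc X (2 * X), (∑ a ∈ A, oddJacobi a m) ^ 2 ≤
      9 * X * L * (1 + Real.log L) + 8 * (1 + Real.log (4 * L ^ 2)) * (K ^ 2 * L) := by
  have h := sum_norm_sq_oddJacobi_le (S := A) (H := L) hA hX (c := fun _ _ => 1) (E := fun _ => 1)
    (W := fun _ => 0) (by simp) (by simp)
  have h1 : ∀ m, ‖∑ a ∈ A, (1 : ℂ) * oddJacobi a m‖ ^ 2 = (∑ a ∈ A, oddJacobi a m) ^ 2 := by
    intro m
    simp_rw [one_mul]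
    rw [← Complex.ofReal_sum, Complex.norm_real, Real.norm_eq_abs, sq_abs]
  simp_rw [h1, mul_one, mul_zero, sum_const_zero, mul_zero, add_zero] at h
  refine h.trans (add_le_add ?_ ?_)
  · have := sum_isSquare_mul_le hA (f := fun _ => 1) (Y := 1) (Z := L) (by simp) (by simp) (by simp)
      (by simp) (fun a ha => by
        have := mem_Icc.1 (hA ha)
        rw [le_div_iff₀ (by exact_mod_cast this.1), one_mul]
        exact_mod_cast this.2)
    simp_rw [mul_one] at this
    calc _ ≤ (X : ℝ) * (9 * L * (1 + Real.log L)) := mul_le_mul_of_nonneg_left this (by positivity)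
      _ = _ := by ring
  · have hs : ∑ a ∈ A, √(a : ℝ) ≤ K * √L := by
      calc _ ≤ ∑ a ∈ A, √(L : ℝ) := by
            refine sum_le_sum fun a ha => Real.sqrt_le_sqrt ?_
            exact_mod_cast (mem_Icc.1 (hA ha)).2
        _ = #A * √(L : ℝ) := by rw [sum_const, nsmul_eq_mul]
        _ ≤ _ := by gcongr
    have hL0 : 0 ≤ 8 * (1 + Real.log (4 * (L : ℝ) ^ 2)) := by
      have := Real.log_natCast_nonneg (4 * L ^ 2)
      push_cast at this
      linarith
    refine mul_le_mul_of_nonneg_left ?_ hL0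
    calc _ ≤ (K * √(L : ℝ)) ^ 2 := pow_le_pow_left₀ (sum_nonneg fun _ _ => Real.sqrt_nonneg _) hs 2
      _ = _ := by rw [mul_pow, Real.sq_sqrt (by positivity)]

/-! ### The smoothed dual sum and its mean square. -/

/-- The terms up to `T` and the tail each have order `√T`. The proof telescopes against `8 t √H /
(√H + t)` with `t = √T`, a majorant bounded by `8 t`. -/
theorem sum_inv_sqrt_mul_min_le {T : ℝ} (hT : 0 < T) (H : ℕ) :
    ∑ h ∈ Icc 1 H, 1 / √(h : ℝ) * min 1 (T / h) ≤ 8 * √T := by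
  set t := √T with ht
  have ht0 : 0 < t := Real.sqrt_pos.2 hT
  have htt : t ^ 2 = T := Real.sq_sqrt hT.le
  suffices h : ∑ h ∈ Icc 1 H, 1 / √(h : ℝ) * min 1 (T / h) ≤ 8 * t * (√H / (√H + t)) by
    refine h.trans (mul_le_of_le_one_right (by positivity) ?_)
    rw [div_le_one (by positivity)]
    linarith
  induction H with
  | zero => simp
  | succ H ih =>
    rw [sum_Icc_succ_top (by omega)]
    set s := √((H + 1 : ℕ) : ℝ) with hs
    set r := √(H : ℝ) with hr
    have hr0 : 0 ≤ r := Real.sqrt_nonneg _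
    have hs2 : s ^ 2 = ((H + 1 : ℕ) : ℝ) := Real.sq_sqrt (by positivity)
    have hr2 : r ^ 2 = H := Real.sq_sqrt (by positivity)
    have hs0 : 0 < s := Real.sqrt_pos.2 (by positivity)
    have hrs : r ≤ s := Real.sqrt_le_sqrt (by push_cast; linarith)
    have hsr : s ^ 2 = r ^ 2 + 1 := by rw [hs2, hr2]; push_cast; ring
    have hdiff : 1 / (2 * s) ≤ s - r := by
      rw [div_le_iff₀ (by positivity)]
      nlinarith
    have hG : s / (s + t) - r / (r + t) = t * (s - r) / ((s + t) * (r + t)) := by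
      field_simp
      ring
    have hmin : min 1 (T / ((H + 1 : ℕ) : ℝ)) ≤ 4 * t ^ 2 / (s + t) ^ 2 := by
      rw [← hs2, ← htt]
      rcases le_total s t with h | h
      · refine (min_le_left _ _).trans ?_
        rw [le_div_iff₀ (by positivity)]
        nlinarith
      · refine (min_le_right _ _).trans ?_
        rw [div_le_div_iff₀ (by positivity) (by positivity)]
        have : (s + t) ^ 2 ≤ 4 * s ^ 2 := by nlinarith
        nlinarith [sq_nonneg t]
    have hstep : 1 / s * min 1 (T / ((H + 1 : ℕ) : ℝ)) ≤ 8 * t * (s / (s + t) - r / (r + t)) := by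
      rw [hG]
      calc _ ≤ 1 / s * (4 * t ^ 2 / (s + t) ^ 2) := by gcongr
        _ = 8 * t * (t * (1 / (2 * s)) / ((s + t) * (s + t))) := by field_simp; ring
        _ ≤ 8 * t * (t * (s - r) / ((s + t) * (r + t))) := by gcongr
    have : 8 * t * (s / (s + t)) = 8 * t * (r / (r + t)) + 8 * t * (s / (s + t) - r / (r + t)) := by
      ring
    rw [this]
    exact add_le_add ih hstep

theorem sum_natCast_mul_exp_eq (N : ℕ) (θ : ℝ) :
    ∑ n ∈ Icc 1 N, (n : ℂ) * Complex.exp (2 * Real.pi * Complex.I * n * θ) =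
      N * expSum N θ - ∑ k ∈ range N, expSum k θ := by
  induction N with
  | zero => simp
  | succ N ih =>
    have h : expSum (N + 1) θ = expSum N θ +
        Complex.exp (2 * Real.pi * Complex.I * (N + 1 : ℕ) * θ) := sum_Icc_succ_top (by omega) _
    rw [sum_Icc_succ_top (by omega), ih, h, sum_range_succ]
    push_cast
    ring

theorem hasDerivAt_expSum (N : ℕ) (θ : ℝ) :
    HasDerivAt (expSum N) (2 * Real.pi * Complex.I *
      ∑ n ∈ Icc 1 N, (n : ℂ) * Complex.exp (2 * Real.pi * Complex.I * n * θ)) θ := by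
  unfold expSum
  rw [mul_sum]
  refine HasDerivAt.fun_sum fun n _ => ?_
  have h := ((Complex.ofRealCLM.hasDerivAt (x := θ)).const_mul
    (2 * Real.pi * Complex.I * n)).cexp
  refine h.congr_deriv ?_
  simp
  ring

theorem norm_expSum_le_min {N : ℕ} {a θ : ℝ} (ha : 0 < a) (h1 : a ≤ θ) (h2 : θ ≤ 1 / 2) :
    ‖expSum N θ‖ ≤ min (N : ℝ) (1 / (2 * a)) := by
  refine le_min (norm_expSum_le_card N θ) ((norm_expSum_le_inv (ha.trans_le h1) h2).trans ?_)
  exact one_div_le_one_div_of_le (by positivity) (by linarith)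

/-- By the mean value inequality it suffices to bound the derivative `2πi ∑ n e(nθ)`. Abel summation
writes it through `2N` exponential sums of length at most `N`, each subject to the same minimum. -/
theorem norm_expSum_sub_le {N : ℕ} {a b : ℝ} (ha : 0 < a) (hab : a ≤ b) (hb : b ≤ 1 / 2) :
    ‖expSum N b - expSum N a‖ ≤ 4 * Real.pi * N * min (N : ℝ) (1 / (2 * a)) * (b - a) := by
  have h := (convex_Icc a b).norm_image_sub_le_of_norm_hasDerivWithin_le (f := expSum N)
    (C := 4 * Real.pi * N * min (N : ℝ) (1 / (2 * a)))
    (fun θ _ => (hasDerivAt_expSum N θ).hasDerivWithinAt) (fun θ hθ => ?_)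
    (Set.left_mem_Icc.2 hab) (Set.right_mem_Icc.2 hab)
  · rwa [Real.norm_eq_abs, abs_of_nonneg (by linarith)] at h
  · have hθ2 : θ ≤ 1 / 2 := hθ.2.trans hb
    have hk : ∀ k ≤ N, ‖expSum k θ‖ ≤ min (N : ℝ) (1 / (2 * a)) := fun k hk =>
      (norm_expSum_le_min ha hθ.1 hθ2).trans (min_le_min_right _ (by exact_mod_cast hk))
    rw [sum_natCast_mul_exp_eq, norm_mul]
    have h1 : ‖(2 * Real.pi * Complex.I : ℂ)‖ = 2 * Real.pi := by
      simp [abs_of_pos Real.pi_pos]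
    rw [h1]
    have h2 : ‖(N : ℂ) * expSum N θ - ∑ k ∈ range N, expSum k θ‖ ≤
        2 * N * min (N : ℝ) (1 / (2 * a)) := by
      calc _ ≤ ‖(N : ℂ) * expSum N θ‖ + ‖∑ k ∈ range N, expSum k θ‖ := norm_sub_le _ _
        _ ≤ N * min (N : ℝ) (1 / (2 * a)) + ∑ k ∈ range N, min (N : ℝ) (1 / (2 * a)) := by
            refine add_le_add ?_ ((norm_sum_le _ _).trans (sum_le_sum fun k hk' =>
              hk k (mem_range.1 hk').le))
            rw [norm_mul, Complex.norm_natCast]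
            exact mul_le_mul_of_nonneg_left (hk N le_rfl) (by positivity)
        _ = _ := by rw [sum_const, card_range, nsmul_eq_mul]; ring
    calc _ ≤ 2 * Real.pi * (2 * N * min (N : ℝ) (1 / (2 * a))) := by gcongr
      _ = _ := by ring

/-- The exponential sum of length `N` smoothed twice at scale `D`. -/
noncomputable def smoothExpSum (N D : ℕ) (θ : ℝ) : ℂ := expSum N θ * (expSum D θ / D) ^ 2

theorem norm_expSum_div_le {D : ℕ} (hD : 0 < D) {a θ : ℝ} (ha : 0 < a) (h1 : a ≤ θ)
    (h2 : θ ≤ 1 / 2) : ‖expSum D θ / D‖ ≤ min 1 (1 / (2 * a) / D) := by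
  have hD' : (0 : ℝ) < D := by exact_mod_cast hD
  have h := norm_expSum_le_min (N := D) ha h1 h2
  rw [norm_div, Complex.norm_natCast]
  refine le_min ?_ ?_
  · rw [div_le_one hD']; exact h.trans (min_le_left _ _)
  · gcongr; exact h.trans (min_le_right _ _)

theorem norm_smoothExpSum_le {N D : ℕ} (hD : 0 < D) {a θ : ℝ} (ha : 0 < a) (h1 : a ≤ θ)
    (h2 : θ ≤ 1 / 2) :
    ‖smoothExpSum N D θ‖ ≤ min (N : ℝ) (1 / (2 * a)) * min 1 (1 / (2 * a) / D) ^ 2 := by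
  rw [smoothExpSum, norm_mul, norm_pow]
  exact mul_le_mul (norm_expSum_le_min ha h1 h2)
    (pow_le_pow_left₀ (norm_nonneg _) (norm_expSum_div_le hD ha h1 h2) 2) (by positivity)
    (by positivity)

/-- Product rule for differences: the long factor contributes `4π N`, and the two smoothing factors
contribute `4π D ≤ 4π N` each. -/
theorem norm_smoothExpSum_sub_le {N D : ℕ} (hD : 0 < D) (hDN : D ≤ N) {a b : ℝ} (ha : 0 < a)
    (hab : a ≤ b) (hb : b ≤ 1 / 2) :
    ‖smoothExpSum N D b - smoothExpSum N D a‖ ≤ 12 * Real.pi * N *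
      (min (N : ℝ) (1 / (2 * a)) * min 1 (1 / (2 * a) / D) ^ 2) * (b - a) := by
  have hD' : (0 : ℝ) < D := by exact_mod_cast hD
  have hDN' : (D : ℝ) ≤ N := by exact_mod_cast hDN
  set β := min (N : ℝ) (1 / (2 * a))
  set γ := min 1 (1 / (2 * a) / D)
  have hβ0 : 0 ≤ β := by positivity
  have hγ0 : 0 ≤ γ := by positivity
  have hba : 0 ≤ b - a := by linarith
  have h1 : ‖expSum N b - expSum N a‖ ≤ 4 * Real.pi * N * β * (b - a) := norm_expSum_sub_le ha hab hb
  have hNa : ‖expSum N a‖ ≤ β := norm_expSum_le_min ha le_rfl (hab.trans hb)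
  have hDa : ‖expSum D a / D‖ ≤ γ := norm_expSum_div_le hD ha le_rfl (hab.trans hb)
  have hDb : ‖expSum D b / D‖ ≤ γ := norm_expSum_div_le hD ha hab hb
  have h2 : ‖expSum D b / D - expSum D a / D‖ ≤ 4 * Real.pi * N * γ * (b - a) := by
    rw [← sub_div, norm_div, Complex.norm_natCast]
    calc _ ≤ 4 * Real.pi * D * min (D : ℝ) (1 / (2 * a)) * (b - a) / D := by
          gcongr; exact norm_expSum_sub_le ha hab hb
      _ = 4 * Real.pi * D * (min (D : ℝ) (1 / (2 * a)) / D) * (b - a) := by ring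
      _ = 4 * Real.pi * D * γ * (b - a) := by
          rw [← min_div_div_right hD'.le, div_self hD'.ne']
      _ ≤ _ := by gcongr
  have hid : smoothExpSum N D b - smoothExpSum N D a =
      (expSum N b - expSum N a) * (expSum D b / D) ^ 2 +
      expSum N a * ((expSum D b / D - expSum D a / D) * (expSum D b / D + expSum D a / D)) := by
    unfold smoothExpSum; ring
  rw [hid]
  calc _ ≤ 4 * Real.pi * N * β * (b - a) * γ ^ 2 +
        β * (4 * Real.pi * N * γ * (b - a) * (γ + γ)) := by
        refine (norm_add_le _ _).trans ?_
        rw [norm_mul, norm_mul, norm_mul, norm_pow]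
        gcongr
        exact (norm_add_le _ _).trans (add_le_add hDb hDa)
    _ = _ := by ring

/-- Majorant of `smoothExpSum N D (h / m)` for `X < m ≤ 2 * X`. -/
noncomputable def dualWeight (N D X h : ℕ) : ℝ :=
  min (N : ℝ) (X / h) * min 1 ((X : ℝ) / D / h) ^ 2

theorem dualWeight_nonneg (N D X h : ℕ) : 0 ≤ dualWeight N D X h := by
  unfold dualWeight; positivity

/-- The dual coefficients, cut off at `2 * h < m`. -/
noncomputable def dualCoeff (N D h m : ℕ) : ℂ :=
  -- Frequencies above 1/2 are conjugate to those below, so only the range where `expSum` decays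
  -- like `1/θ` is kept.
  if 2 * h < m then smoothExpSum N D ((h : ℝ) / m) else 0

theorem dualWeight_ge {N D X h : ℕ} (hh : 0 < h) (hX : 0 < X) {a : ℝ}
    (ha : (h : ℝ) / (2 * X) ≤ a) :
    min (N : ℝ) (1 / (2 * a)) * min 1 (1 / (2 * a) / D) ^ 2 ≤ dualWeight N D X h := by
  have hh' : (0 : ℝ) < h := by exact_mod_cast hh
  have hX' : (0 : ℝ) < X := by exact_mod_cast hX
  have ha0 : 0 < a := lt_of_lt_of_le (by positivity) ha
  have h1 : 1 / (2 * a) ≤ X / h := by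
    rw [div_le_div_iff₀ (by positivity) hh']
    rw [div_le_iff₀ (by positivity)] at ha
    linarith
  have h2 : 1 / (2 * a) / D ≤ X / D / h := by
    rw [div_right_comm (X : ℝ)]
    gcongr
  unfold dualWeight
  gcongr

theorem norm_dualCoeff_le {N D X h m : ℕ} (hD : 0 < D) (hh : 0 < h) (hX : 0 < X)
    (hm : m ∈ Ioc X (2 * X)) : ‖dualCoeff N D h m‖ ≤ dualWeight N D X h := by
  unfold dualCoeff
  split_ifs with h2
  · have hm := mem_Ioc.1 hm
    have hh' : (0 : ℝ) < h := by exact_mod_cast hh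
    have hm' : (0 : ℝ) < m := by exact_mod_cast (by omega : 0 < m)
    have h3 : (m : ℝ) ≤ 2 * X := by exact_mod_cast hm.2
    have h4 : (2 : ℝ) * h < m := by exact_mod_cast h2
    refine (norm_smoothExpSum_le hD (a := (h : ℝ) / m) (by positivity) le_rfl ?_).trans
      (dualWeight_ge hh hX (by gcongr))
    rw [div_le_div_iff₀ hm' (by norm_num)]
    linarith
  · rw [norm_zero]; exact dualWeight_nonneg _ _ _ _

/-- The cutoff makes the coefficient jump only at `m = 2 * h`, at the cost of one weight. Past it,
the argument moves by `h / m - h / (m + 1) ≤ h / X²`. -/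
theorem norm_dualCoeff_sub_le {N D X h m : ℕ} (hD : 0 < D) (hDN : D ≤ N) (hh : 0 < h) (hX : 0 < X)
    (hm : m ∈ Ioo X (2 * X)) :
    ‖dualCoeff N D h (m + 1) - dualCoeff N D h m‖ ≤
      (if m = 2 * h then dualWeight N D X h else 0) +
        12 * Real.pi * N * dualWeight N D X h * (h / X ^ 2) := by
  have hm := mem_Ioo.1 hm
  have hw := dualWeight_nonneg N D X h
  have hw2 : 0 ≤ 12 * Real.pi * N * dualWeight N D X h * (h / X ^ 2) := by positivity
  rcases lt_trichotomy m (2 * h) with hlt | heq | hgt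
  · have h1 : dualCoeff N D h m = 0 := if_neg (by omega)
    have h2 : dualCoeff N D h (m + 1) = 0 := if_neg (by omega)
    rw [h1, h2, sub_zero, norm_zero, if_neg (by omega), zero_add]
    exact hw2
  · have h1 : dualCoeff N D h m = 0 := if_neg (by omega)
    rw [h1, sub_zero, if_pos heq]
    have := norm_dualCoeff_le (N := N) hD hh hX (mem_Ioc.2 ⟨by omega, by omega⟩ : m + 1 ∈ Ioc X (2 * X))
    linarith
  · have h1 : dualCoeff N D h m = smoothExpSum N D ((h : ℝ) / m) := if_pos hgt
    have h2 : dualCoeff N D h (m + 1) = smoothExpSum N D ((h : ℝ) / (m + 1 : ℕ)) := if_pos (by omega)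
    rw [h1, h2, if_neg (by omega), zero_add, norm_sub_rev]
    have hh' : (0 : ℝ) < h := by exact_mod_cast hh
    have hX' : (0 : ℝ) < X := by exact_mod_cast hX
    have hm' : (X : ℝ) < m := by exact_mod_cast hm.1
    have hm0 : (0 : ℝ) < m := hX'.trans hm'
    have h3 : ((m + 1 : ℕ) : ℝ) ≤ 2 * X := by exact_mod_cast (by omega : m + 1 ≤ 2 * X)
    have h4 : (2 : ℝ) * h < m := by exact_mod_cast hgt
    have hle : (h : ℝ) / (m + 1 : ℕ) ≤ h / m := by
      gcongr; linarith
    refine (norm_smoothExpSum_sub_le hD hDN (a := (h : ℝ) / (m + 1 : ℕ)) (b := (h : ℝ) / m)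
      (by positivity) hle ?_).trans ?_
    · rw [div_le_div_iff₀ hm0 (by norm_num)]
      linarith
    · have hd : (h : ℝ) / m - h / (m + 1 : ℕ) ≤ h / X ^ 2 := by
        have : (h : ℝ) / m - h / (m + 1 : ℕ) = h / (m * (m + 1)) := by
          push_cast; field_simp; ring
        rw [this]
        gcongr
        nlinarith
      have hd0 : 0 ≤ (h : ℝ) / m - h / (m + 1 : ℕ) := by linarith
      have hwt := dualWeight_ge (N := N) (D := D) hh hX (a := (h : ℝ) / (m + 1 : ℕ)) (by gcongr)
      gcongr

theorem sum_norm_dualCoeff_sub_le {N D X h : ℕ} (hD : 0 < D) (hDN : D ≤ N) (hh : 0 < h)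
    (hX : 0 < X) :
    ∑ m ∈ Ioo X (2 * X), ‖dualCoeff N D h (m + 1) - dualCoeff N D h m‖ ≤
      dualWeight N D X h + 12 * Real.pi * N / X * (h * dualWeight N D X h) := by
  have hX' : (0 : ℝ) < X := by exact_mod_cast hX
  have hw := dualWeight_nonneg N D X h
  calc _ ≤ ∑ m ∈ Ioo X (2 * X), ((if m = 2 * h then dualWeight N D X h else 0) +
        12 * Real.pi * N * dualWeight N D X h * (h / X ^ 2)) :=
        sum_le_sum fun m hm => norm_dualCoeff_sub_le hD hDN hh hX hm
    _ ≤ dualWeight N D X h + X * (12 * Real.pi * N * dualWeight N D X h * (h / X ^ 2)) := by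
        rw [sum_add_distrib, sum_ite_eq', sum_const, nsmul_eq_mul, Nat.card_Ioo]
        refine add_le_add ?_ ?_
        · split_ifs
          · exact le_rfl
          · exact hw
        · refine mul_le_mul_of_nonneg_right ?_ (by positivity)
          exact_mod_cast (by omega : 2 * X - X - 1 ≤ X)
    _ = _ := by field_simp

theorem sqrt_mul_dualWeight_le {N D X h : ℕ} (hh : 0 < h) :
    √(h : ℝ) * dualWeight N D X h ≤ X * (1 / √(h : ℝ) * min 1 ((X : ℝ) / D / h)) := by
  have hh' : (0 : ℝ) < h := by exact_mod_cast hh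
  have hs : 0 < √(h : ℝ) := Real.sqrt_pos.2 hh'
  have hss : √(h : ℝ) * √h = h := Real.mul_self_sqrt hh'.le
  have h0 : 0 ≤ min 1 ((X : ℝ) / D / h) := by positivity
  have h1 : min 1 ((X : ℝ) / D / h) ≤ 1 := min_le_left _ _
  unfold dualWeight
  calc _ ≤ √(h : ℝ) * (X / h * min 1 ((X : ℝ) / D / h)) := by
        gcongr
        · exact min_le_right _ _
        · rw [sq]; exact mul_le_of_le_one_left h0 h1
    _ = _ := by
        have : √(h : ℝ) = h / √h := by rw [eq_div_iff hs.ne', hss]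
        conv_lhs => rw [this]
        field_simp

/-- This is why the smoothing is done twice: one factor `min(1, X / (D h))` absorbs the extra `h`
coming from the variation in `m`, and the other is left to make the sum over `h` converge. -/
theorem sqrt_mul_mul_dualWeight_le {N D X h : ℕ} (hh : 0 < h) :
    √(h : ℝ) * (h * dualWeight N D X h) ≤
      X * (X / D) * (1 / √(h : ℝ) * min 1 ((X : ℝ) / D / h)) := by
  have hh' : (0 : ℝ) < h := by exact_mod_cast hh
  have hs : 0 < √(h : ℝ) := Real.sqrt_pos.2 hh'
  have hss : √(h : ℝ) * √h = h := Real.mul_self_sqrt hh'.le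
  have h0 : 0 ≤ min 1 ((X : ℝ) / D / h) := by positivity
  have h1 : h * min 1 ((X : ℝ) / D / h) ≤ X / D := by
    rw [← le_div_iff₀' hh']; exact min_le_right _ _
  unfold dualWeight
  calc _ ≤ √(h : ℝ) * (h * (X / h * min 1 ((X : ℝ) / D / h) ^ 2)) := by
        gcongr
        exact min_le_right _ _
    _ = X * (1 / √(h : ℝ) * (h * min 1 ((X : ℝ) / D / h)) * min 1 ((X : ℝ) / D / h)) := by
        have : √(h : ℝ) = h / √h := by rw [eq_div_iff hs.ne', hss]
        conv_lhs => rw [this]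
        field_simp
    _ ≤ X * (1 / √(h : ℝ) * (X / D) * min 1 ((X : ℝ) / D / h)) := by gcongr
    _ = _ := by ring

/-- The square pairs, with `Y = N` and `Z = X`, give `X² N log X`. The others give `X² T` and `X N
T²` up to a logarithm, where `T = X / D` is the effective length; both are at most `X² N` since `T ≤
D ≤ N` and `T² ≤ X`. -/
theorem sum_norm_sq_dual_le {N D X : ℕ} (hX : 0 < X) (hDX : X ≤ D ^ 2) (hDN : D ≤ N) :
    ∑ m ∈ Ioc X (2 * X), ‖∑ h ∈ Icc 1 X, dualCoeff N D h m * oddJacobi h m‖ ^ 2 ≤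
      130000 * X ^ 2 * N * (1 + Real.log X) := by
  have hD : 0 < D := by
    rcases Nat.eq_zero_or_pos D with rfl | h
    · simp at hDX; omega
    · exact h
  have hX' : (1 : ℝ) ≤ X := by exact_mod_cast hX
  have hD' : (0 : ℝ) < D := by exact_mod_cast hD
  have hDX' : (X : ℝ) ≤ (D : ℝ) ^ 2 := by exact_mod_cast hDX
  have hDN' : (D : ℝ) ≤ N := by exact_mod_cast hDN
  have hmain := sum_norm_sq_oddJacobi_le (S := Icc 1 X) (H := X) subset_rfl hX
    (c := dualCoeff N D) (E := dualWeight N D X)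
    (W := fun h => dualWeight N D X h + 12 * Real.pi * N / X * (h * dualWeight N D X h))
    (fun h hh m hm => norm_dualCoeff_le hD (mem_Icc.1 hh).1 hX hm)
    (fun h hh => sum_norm_dualCoeff_sub_le hD hDN (mem_Icc.1 hh).1 hX)
  have hdiag := sum_isSquare_mul_le (S := Icc 1 X) (H := X) subset_rfl (f := dualWeight N D X)
    (Y := N) (Z := X) (fun h _ => dualWeight_nonneg _ _ _ _) (by positivity) (by positivity)
    (fun h _ => by
      unfold dualWeight
      refine (mul_le_of_le_one_right (by positivity) ?_).trans (min_le_left _ _)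
      exact pow_le_one₀ (by positivity) (min_le_left _ _))
    (fun h _ => by
      unfold dualWeight
      refine (mul_le_of_le_one_right (by positivity) ?_).trans (min_le_right _ _)
      exact pow_le_one₀ (by positivity) (min_le_left _ _))
  set T : ℝ := (X : ℝ) / D with hT
  have hT0 : 0 < T := by positivity
  have hTD : T ≤ D := by rw [hT, div_le_iff₀ hD', ← sq]; exact hDX'
  have hTX : T * T ≤ X := by
    calc T * T ≤ T * D := by gcongr
      _ = X := by rw [hT]; field_simp
  have hsum := sum_inv_sqrt_mul_min_le hT0 X
  set a := ∑ h ∈ Icc 1 X, √(h : ℝ) * dualWeight N D X h with ha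
  set b := ∑ h ∈ Icc 1 X, √(h : ℝ) * (h * dualWeight N D X h) with hb
  have ha0 : 0 ≤ a := sum_nonneg fun h _ => mul_nonneg (by positivity) (dualWeight_nonneg _ _ _ _)
  have hb0 : 0 ≤ b := sum_nonneg fun h _ => mul_nonneg (by positivity)
    (mul_nonneg (by positivity) (dualWeight_nonneg _ _ _ _))
  have ha1 : a ≤ 8 * X * √T := by
    calc a ≤ ∑ h ∈ Icc 1 X, X * (1 / √(h : ℝ) * min 1 (T / h)) :=
          sum_le_sum fun h hh => sqrt_mul_dualWeight_le (mem_Icc.1 hh).1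
      _ ≤ X * (8 * √T) := by rw [← mul_sum]; gcongr
      _ = _ := by ring
  have hb1 : b ≤ 8 * X * T * √T := by
    calc b ≤ ∑ h ∈ Icc 1 X, X * T * (1 / √(h : ℝ) * min 1 (T / h)) :=
          sum_le_sum fun h hh => sqrt_mul_mul_dualWeight_le (mem_Icc.1 hh).1
      _ ≤ X * T * (8 * √T) := by rw [← mul_sum]; gcongr
      _ = _ := by ring
  have hW : ∑ h ∈ Icc 1 X, √(h : ℝ) *
      (dualWeight N D X h + 12 * Real.pi * N / X * (h * dualWeight N D X h)) =
      a + 12 * Real.pi * N / X * b := by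
    rw [ha, hb, mul_sum, ← sum_add_distrib]
    exact sum_congr rfl fun h _ => by ring
  rw [hW] at hmain
  have hpi : 12 * Real.pi ≤ 38 := by linarith [Real.pi_lt_d2]
  have hTs : √T * √T = T := Real.mul_self_sqrt hT0.le
  have hoff : a ^ 2 + 2 * a * (a + 12 * Real.pi * N / X * b) ≤ 5056 * X ^ 2 * N := by
    calc _ ≤ (8 * X * √T) ^ 2 + 2 * (8 * X * √T) * (8 * X * √T + 38 * N / X * (8 * X * T * √T)) := by
          gcongr
      _ = 192 * X ^ 2 * (√T * √T) + 4864 * X * N * (T * (√T * √T)) := by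
          field_simp; ring
      _ ≤ 192 * X ^ 2 * N + 4864 * X * N * X := by
          rw [hTs]
          gcongr
          linarith
      _ = _ := by ring
  have hoff0 : 0 ≤ a ^ 2 + 2 * a * (a + 12 * Real.pi * N / X * b) := by positivity
  have hlogX : 0 ≤ Real.log X := Real.log_natCast_nonneg X
  have hlog : 1 + Real.log (4 * (X : ℝ) ^ 2) ≤ 3 * (1 + Real.log X) := by
    rw [Real.log_mul (by norm_num) (by positivity), Real.log_pow]
    have : Real.log 4 ≤ 2 := by
      rw [show (4 : ℝ) = 2 ^ 2 by norm_num, Real.log_pow]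
      have := Real.log_two_lt_d9
      push_cast
      linarith
    push_cast
    linarith
  have hlog0 : 0 ≤ 1 + Real.log (4 * (X : ℝ) ^ 2) := by
    have := Real.log_nonneg (x := 4 * (X : ℝ) ^ 2) (by nlinarith)
    linarith
  refine hmain.trans ?_
  calc _ ≤ (X : ℝ) * (9 * N * X * (1 + Real.log X)) +
        8 * (3 * (1 + Real.log X)) * (5056 * X ^ 2 * N) := by
        gcongr
    _ = (9 + 24 * 5056) * (X ^ 2 * N * (1 + Real.log X)) := by ring
    _ ≤ 130000 * (X ^ 2 * N * (1 + Real.log X)) := by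
        gcongr; norm_num
    _ = _ := by ring

/-! ### Duality for the quadratic character modulo a prime. -/

/-- The quadratic character modulo a prime, with complex values. -/
noncomputable def complexQuadraticChar (p : ℕ) [Fact p.Prime] : DirichletCharacter ℂ p :=
  (quadraticChar (ZMod p)).ringHomComp (Int.castRingHom ℂ)

theorem complexQuadraticChar_natCast {p : ℕ} [Fact p.Prime] (hp : Odd p) (n : ℕ) :
    complexQuadraticChar p (n : ZMod p) = (oddJacobi n p : ℂ) := by
  have h : quadraticChar (ZMod p) (n : ZMod p) = jacobiSym n p := by
    rw [← jacobiSym.legendreSym.to_jacobiSym, legendreSym, Int.cast_natCast]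
  rw [complexQuadraticChar, MulChar.ringHomComp_apply, h, oddJacobi, if_pos hp]
  simp

theorem complexQuadraticChar_inv (p : ℕ) [Fact p.Prime] :
    (complexQuadraticChar p)⁻¹ = complexQuadraticChar p :=
  ((quadraticChar_isQuadratic (ZMod p)).comp (Int.castRingHom ℂ)).inv

theorem complexQuadraticChar_isPrimitive {p : ℕ} [hp : Fact p.Prime] (hodd : Odd p) :
    (complexQuadraticChar p).IsPrimitive := by
  have hne : complexQuadraticChar p ≠ 1 := by
    have h2 : ringChar (ZMod p) ≠ 2 := by
      rw [ZMod.ringChar_zmod_n]; rintro rfl; exact absurd hodd (by decide)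
    exact (MulChar.ringHomComp_ne_one_iff Int.cast_injective).2 (quadraticChar_ne_one h2)
  rcases (Nat.dvd_prime hp.out).1 (complexQuadraticChar p).conductor_dvd_level with h | h
  · exact absurd ((complexQuadraticChar p).eq_one_iff_conductor_eq_one.2 h) hne
  · exact h

theorem sum_exp_triple (N D : ℕ) (θ : ℝ) :
    ∑ i ∈ Icc 1 D, ∑ j ∈ Icc 1 D, ∑ b ∈ Icc 1 N,
      Complex.exp (2 * Real.pi * Complex.I * (b + i + j : ℕ) * θ) = expSum N θ * expSum D θ ^ 2 := by
  unfold expSum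
  rw [sq, sum_mul_sum, mul_sum]
  refine sum_congr rfl fun i _ => ?_
  rw [mul_sum]
  refine sum_congr rfl fun j _ => ?_
  rw [sum_mul]
  refine sum_congr rfl fun b _ => ?_
  rw [← Complex.exp_add, ← Complex.exp_add]
  congr 1
  push_cast
  ring

theorem sum_range_prime_eq {M : Type*} [AddCommMonoid M] {p X : ℕ} (hodd : Odd p)
    (hp : p ≤ 2 * X) (f : ℕ → M) (h0 : f 0 = 0) :
    ∑ h ∈ range p, f h = ∑ h ∈ Icc 1 X with 2 * h < p, (f h + f (p - h)) := by
  obtain ⟨k, rfl⟩ := hodd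
  have h1 : (Icc 1 X).filter (fun h => 2 * h < 2 * k + 1) = Icc 1 k := by
    ext h; simp only [mem_filter, mem_Icc]; omega
  have h2 : ∑ h ∈ range (2 * k + 1), f h = ∑ h ∈ Icc 1 k, f h + ∑ h ∈ Icc (k + 1) (2 * k), f h := by
    rw [← sum_union]
    · symm
      refine sum_subset ?_ fun h hh hh' => ?_
      · intro h; simp only [mem_union, mem_Icc, mem_range]; omega
      · have : h = 0 := by simp only [mem_union, mem_Icc, mem_range] at hh hh'; omega
        rw [this, h0]
    · rw [disjoint_left]; intro h; simp only [mem_Icc]; omega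
  rw [h1, h2, sum_add_distrib]
  congr 1
  refine sum_nbij' (fun h => 2 * k + 1 - h) (fun h => 2 * k + 1 - h) ?_ ?_ ?_ ?_ ?_
  · intro h; simp only [mem_Icc]; omega
  · intro h; simp only [mem_Icc]; omega
  · intro h; simp only [mem_Icc]; omega
  · intro h; simp only [mem_Icc]; omega
  · intro h hh
    simp only [mem_Icc] at hh
    congr 1; omega

/-- Multiplying by the Gauss sum, of modulus `√p`, replaces the character by additive ones, and the
triple sum factors into exponential sums. Pairing `h` with `p - h` yields `P + χ(-1) conj(P)` for
the truncated dual sum `P`, hence the factor 2. -/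
theorem sqrt_mul_abs_sum_triple_le {p X N D : ℕ} (hp : p.Prime) (hodd : Odd p) (hpX : p ≤ 2 * X)
    (hD : 0 < D) :
    √(p : ℝ) * |∑ i ∈ Icc 1 D, ∑ j ∈ Icc 1 D, ∑ b ∈ Icc 1 N, oddJacobi (b + i + j) p| ≤
      2 * D ^ 2 * ‖∑ h ∈ Icc 1 X, dualCoeff N D h p * oddJacobi h p‖ := by
  have : Fact p.Prime := ⟨hp⟩
  have hpr := complexQuadraticChar_isPrimitive (p := p) hodd
  set χ := complexQuadraticChar p with hχ
  have hD' : (D : ℂ) ≠ 0 := by exact_mod_cast hD.ne'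
  have hτ : ‖gaussSum χ ZMod.stdAddChar‖ = √p := norm_gaussSum_of_isPrimitive hpr
  have hexp : gaussSum χ ZMod.stdAddChar *
      ((∑ i ∈ Icc 1 D, ∑ j ∈ Icc 1 D, ∑ b ∈ Icc 1 N, oddJacobi (b + i + j) p : ℝ) : ℂ) =
      D ^ 2 * ∑ h ∈ range p, χ h * smoothExpSum N D ((h : ℝ) / p) := by
    push_cast
    calc _ = ∑ i ∈ Icc 1 D, ∑ j ∈ Icc 1 D, ∑ b ∈ Icc 1 N, ∑ h ∈ range p,
          χ h * Complex.exp (2 * Real.pi * Complex.I * (b + i + j : ℕ) * ((h / p : ℝ) : ℂ)) := by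
          simp_rw [mul_sum]
          refine sum_congr rfl fun i _ => sum_congr rfl fun j _ => sum_congr rfl fun b _ => ?_
          have := gaussSum_mul_apply_of_isPrimitive hpr (b + i + j)
          rw [complexQuadraticChar_inv, complexQuadraticChar_natCast hodd] at this
          exact this
      _ = ∑ h ∈ range p, χ h * (expSum N ((h : ℝ) / p) * expSum D ((h : ℝ) / p) ^ 2) := by
          simp_rw [← sum_exp_triple, mul_sum]
          symm
          rw [sum_comm]
          refine sum_congr rfl fun i _ => ?_
          rw [sum_comm]
          refine sum_congr rfl fun j _ => ?_
          rw [sum_comm]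
      _ = _ := by
          rw [mul_sum]
          refine sum_congr rfl fun h _ => ?_
          unfold smoothExpSum
          field_simp
  set P := ∑ h ∈ Icc 1 X, dualCoeff N D h p * oddJacobi h p with hP
  have hp0 : (p : ℝ) ≠ 0 := by exact_mod_cast hp.ne_zero
  have hfold : ∑ h ∈ range p, χ h * smoothExpSum N D ((h : ℝ) / p) =
      P + χ (-1) * (starRingEnd ℂ) P := by
    rw [sum_range_prime_eq hodd hpX _ (by
      rw [Nat.cast_zero, DirichletCharacter.map_zero' χ hp.one_lt.ne', zero_mul]), hP, map_sum,
      mul_sum, ← sum_add_distrib, sum_filter]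
    refine sum_congr rfl fun h _ => ?_
    unfold dualCoeff
    split_ifs with hh
    · have h1 : χ ((p - h : ℕ) : ZMod p) = χ (-1) * (oddJacobi h p : ℂ) := by
        rw [← complexQuadraticChar_natCast hodd, ← map_mul, Nat.cast_sub (by omega)]
        simp
      have h2 : smoothExpSum N D (((p - h : ℕ) : ℝ) / p) =
          (starRingEnd ℂ) (smoothExpSum N D ((h : ℝ) / p)) := by
        have : ((p - h : ℕ) : ℝ) / p = 1 - (h : ℝ) / p := by
          rw [Nat.cast_sub (by omega)]; field_simp
        rw [this]
        unfold smoothExpSum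
        rw [expSum_one_sub, expSum_one_sub]
        simp
      rw [h1, h2, complexQuadraticChar_natCast hodd, map_mul, Complex.conj_ofReal]
      ring
    · simp
  have hnorm := congrArg norm hexp
  rw [norm_mul, hτ, Complex.norm_real, Real.norm_eq_abs, hfold] at hnorm
  rw [hnorm, norm_mul, norm_pow, Complex.norm_natCast]
  have : ‖P + χ (-1) * (starRingEnd ℂ) P‖ ≤ 2 * ‖P‖ := by
    refine (norm_add_le _ _).trans ?_
    rw [norm_mul, RCLike.norm_conj]
    have := DirichletCharacter.norm_le_one χ (-1)
    nlinarith [norm_nonneg P]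
  calc _ ≤ (D : ℝ) ^ 2 * (2 * ‖P‖) := by gcongr
    _ = _ := by ring

/-- The odd primes in `(X, 2X]`. -/
def oddPrimesDyadic (X : ℕ) : Finset ℕ := {p ∈ Ioc X (2 * X) | p.Prime ∧ Odd p}

/-- Squaring the duality bound and dividing by `p > X` saves a factor `X` over the dual mean square;
positivity allows the primes to be enlarged to all `m` in the dyadic interval. -/
theorem sum_sq_sum_triple_le {X N D : ℕ} (hX : 0 < X) (hDX : X ≤ D ^ 2) (hDN : D ≤ N) :
    ∑ p ∈ oddPrimesDyadic X,
      (∑ i ∈ Icc 1 D, ∑ j ∈ Icc 1 D, ∑ b ∈ Icc 1 N, oddJacobi (b + i + j) p) ^ 2 ≤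
      D ^ 4 * (520000 * X * N * (1 + Real.log X)) := by
  have hX' : (0 : ℝ) < X := by exact_mod_cast hX
  have hD : 0 < D := by
    rcases Nat.eq_zero_or_pos D with rfl | h
    · simp at hDX; omega
    · exact h
  calc _ ≤ ∑ p ∈ oddPrimesDyadic X, 4 * D ^ 4 / X *
        ‖∑ h ∈ Icc 1 X, dualCoeff N D h p * oddJacobi h p‖ ^ 2 := by
        refine sum_le_sum fun p hp => ?_
        obtain ⟨hpm, hpp, hodd⟩ := mem_filter.1 hp
        have hpm := mem_Ioc.1 hpm
        have h := sqrt_mul_abs_sum_triple_le (N := N) hpp hodd hpm.2 hD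
        set G := ∑ i ∈ Icc 1 D, ∑ j ∈ Icc 1 D, ∑ b ∈ Icc 1 N, oddJacobi (b + i + j) p
        set P := ‖∑ h ∈ Icc 1 X, dualCoeff N D h p * oddJacobi h p‖
        have h2 := pow_le_pow_left₀ (by positivity) h 2
        rw [mul_pow, Real.sq_sqrt (by positivity), sq_abs] at h2
        have hXp : (X : ℝ) ≤ p := by exact_mod_cast hpm.1.le
        rw [div_mul_eq_mul_div, le_div_iff₀ hX']
        calc G ^ 2 * X ≤ p * G ^ 2 := by rw [mul_comm]; gcongr
          _ ≤ _ := h2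
          _ = _ := by ring
    _ ≤ 4 * D ^ 4 / X * (130000 * X ^ 2 * N * (1 + Real.log X)) := by
        rw [← mul_sum]
        gcongr
        refine le_trans ?_ (sum_norm_sq_dual_le hX hDX hDN)
        exact sum_le_sum_of_subset_of_nonneg (filter_subset _ _) fun _ _ _ => by positivity
    _ = _ := by field_simp; ring

/-! ### Removing the smoothing. -/

theorem sum_shift_eq (f : ℕ → ℝ) (N s : ℕ) :
    ∑ b ∈ Icc 1 N, f b = ∑ b ∈ Icc 1 N, f (b + s) +
      (∑ b ∈ Icc 1 s, f b - ∑ b ∈ Ioc N (N + s), f b) := by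
  have h1 : ∑ b ∈ Icc 1 N, f (b + s) = ∑ b ∈ Ioc s (N + s), f b := by
    refine sum_nbij' (· + s) (· - s) ?_ ?_ ?_ ?_ ?_ <;> intro b <;>
      simp only [mem_Icc, mem_Ioc] <;> first | omega | simp
  have h2 : ∑ b ∈ Icc 1 (N + s), f b = ∑ b ∈ Icc 1 s, f b + ∑ b ∈ Ioc s (N + s), f b := by
    rw [← sum_union]
    · congr 1; ext; simp only [mem_union, mem_Icc, mem_Ioc]; omega
    · rw [disjoint_left]; intro b; simp only [mem_Icc, mem_Ioc]; omega
  have h3 : ∑ b ∈ Icc 1 (N + s), f b = ∑ b ∈ Icc 1 N, f b + ∑ b ∈ Ioc N (N + s), f b := by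
    rw [← sum_union]
    · congr 1; ext; simp only [mem_union, mem_Icc, mem_Ioc]; omega
    · rw [disjoint_left]; intro b; simp only [mem_Icc, mem_Ioc]; omega
  linarith

/-- With `K² ≪ X` the off-diagonal `K² L` is at most of order `X L`, and `L ≪ X²` keeps `log L`
comparable to `log X`. The constants suit `K = 2D` with `D² ≤ 4X`, and `L = 3N` with `N ≤ X²`. -/
theorem sum_sq_oddJacobi_primes_le {A : Finset ℕ} {L K X : ℕ} (hA : A ⊆ Icc 1 L) (hK : #A ≤ K)
    (hX : 0 < X) (hL : 0 < L) (hLX : L ≤ 3 * X ^ 2) (hKX : K ^ 2 ≤ 16 * X) :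
    ∑ p ∈ oddPrimesDyadic X, (∑ a ∈ A, oddJacobi a p) ^ 2 ≤ 700 * X * L * (1 + Real.log X) := by
  have hX' : (1 : ℝ) ≤ X := by exact_mod_cast hX
  have hL' : (1 : ℝ) ≤ L := by exact_mod_cast hL
  have hKX' : (K : ℝ) ^ 2 ≤ 16 * X := by exact_mod_cast hKX
  have hLX' : (L : ℝ) ≤ 3 * (X : ℝ) ^ 2 := by exact_mod_cast hLX
  have hlogX : 0 ≤ Real.log X := Real.log_natCast_nonneg X
  have hlog4 : Real.log 4 ≤ 1.4 := by
    rw [show (4 : ℝ) = 2 ^ 2 by norm_num, Real.log_pow]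
    have := Real.log_two_lt_d9
    push_cast
    linarith
  have hlog3 : Real.log 3 ≤ 1.3 := by
    have h := Real.log_le_sub_one_of_pos (x := 3 / 4) (by norm_num)
    rw [Real.log_div (by norm_num) (by norm_num)] at h
    linarith
  have hlogL : Real.log L ≤ Real.log 3 + 2 * Real.log X := by
    have := Real.log_le_log (by linarith) hLX'
    rw [Real.log_mul (by norm_num) (by positivity), Real.log_pow] at this
    exact_mod_cast this
  have h1 : 1 + Real.log L ≤ 3 * (1 + Real.log X) := by linarith
  have h2 : 1 + Real.log (4 * (L : ℝ) ^ 2) ≤ 5 * (1 + Real.log X) := by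
    rw [Real.log_mul (by norm_num) (by positivity), Real.log_pow]
    push_cast
    linarith
  calc _ ≤ ∑ m ∈ Ioc X (2 * X), (∑ a ∈ A, oddJacobi a m) ^ 2 :=
        sum_le_sum_of_subset_of_nonneg (filter_subset _ _) fun _ _ _ => by positivity
    _ ≤ 9 * X * L * (1 + Real.log L) + 8 * (1 + Real.log (4 * L ^ 2)) * (K ^ 2 * L) :=
        sum_sq_oddJacobi_finset_le hA hK hX
    _ ≤ 9 * X * L * (3 * (1 + Real.log X)) + 8 * (5 * (1 + Real.log X)) * (16 * X * L) := by
        gcongr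
    _ = 667 * (X * L * (1 + Real.log X)) := by ring
    _ ≤ 700 * (X * L * (1 + Real.log X)) := by gcongr; norm_num
    _ = _ := by ring

/-- A shift by `i + j` changes the sum only by two edge blocks of length `i + j`; average over the
`D²` shifts and apply Cauchy–Schwarz to the edges. -/
theorem sq_sum_le_of_smoothing (f : ℕ → ℝ) {N D : ℕ} (hD : 0 < D) :
    (D : ℝ) ^ 4 * (∑ b ∈ Icc 1 N, f b) ^ 2 ≤
      2 * (∑ i ∈ Icc 1 D, ∑ j ∈ Icc 1 D, ∑ b ∈ Icc 1 N, f (b + i + j)) ^ 2 +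
      4 * D ^ 2 * ∑ i ∈ Icc 1 D, ∑ j ∈ Icc 1 D, ((∑ b ∈ Icc 1 (i + j), f b) ^ 2 +
        (∑ b ∈ Ioc N (N + (i + j)), f b) ^ 2) := by
  set S := ∑ b ∈ Icc 1 N, f b
  set G := ∑ i ∈ Icc 1 D, ∑ j ∈ Icc 1 D, ∑ b ∈ Icc 1 N, f (b + i + j)
  set R : ℕ × ℕ → ℝ := fun x => ∑ b ∈ Icc 1 (x.1 + x.2), f b - ∑ b ∈ Ioc N (N + (x.1 + x.2)), f b
  have hid : (D : ℝ) ^ 2 * S = G + ∑ x ∈ Icc 1 D ×ˢ Icc 1 D, R x := by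
    rw [sum_product, ← sum_add_distrib]
    simp_rw [← sum_add_distrib]
    have : ∀ i ∈ Icc 1 D, ∀ j ∈ Icc 1 D, ∑ b ∈ Icc 1 N, f (b + i + j) + R (i, j) = S := by
      intro i _ j _
      simp_rw [S, R, add_assoc]
      exact (sum_shift_eq f N (i + j)).symm
    rw [sum_congr rfl fun i hi => sum_congr rfl fun j hj => this i hi j hj]
    simp only [sum_const, Nat.card_Icc, nsmul_eq_mul, Nat.add_sub_cancel]
    ring
  have hCS : (∑ x ∈ Icc 1 D ×ˢ Icc 1 D, R x) ^ 2 ≤ D ^ 2 * ∑ x ∈ Icc 1 D ×ˢ Icc 1 D, R x ^ 2 := by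
    have := sq_sum_le_card_mul_sum_sq (s := Icc 1 D ×ˢ Icc 1 D) (f := R)
    rw [card_product, Nat.card_Icc, Nat.add_sub_cancel] at this
    push_cast at this
    rwa [← sq] at this
  have hR : ∑ x ∈ Icc 1 D ×ˢ Icc 1 D, R x ^ 2 ≤ 2 * ∑ i ∈ Icc 1 D, ∑ j ∈ Icc 1 D,
      ((∑ b ∈ Icc 1 (i + j), f b) ^ 2 + (∑ b ∈ Ioc N (N + (i + j)), f b) ^ 2) := by
    rw [sum_product, mul_sum]
    refine sum_le_sum fun i _ => ?_
    rw [mul_sum]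
    refine sum_le_sum fun j _ => ?_
    simp only [R]
    nlinarith [sq_nonneg (∑ b ∈ Icc 1 (i + j), f b + ∑ b ∈ Ioc N (N + (i + j)), f b)]
  calc (D : ℝ) ^ 4 * S ^ 2 = (D ^ 2 * S) ^ 2 := by ring
    _ ≤ 2 * G ^ 2 + 2 * (∑ x ∈ Icc 1 D ×ˢ Icc 1 D, R x) ^ 2 := by
        rw [hid]
        nlinarith [sq_nonneg (G - ∑ x ∈ Icc 1 D ×ˢ Icc 1 D, R x)]
    _ ≤ 2 * G ^ 2 + 2 * (D ^ 2 * (2 * ∑ i ∈ Icc 1 D, ∑ j ∈ Icc 1 D,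
      ((∑ b ∈ Icc 1 (i + j), f b) ^ 2 + (∑ b ∈ Ioc N (N + (i + j)), f b) ^ 2))) := by
        gcongr
        exact hCS.trans (by gcongr)
    _ = _ := by ring

/-- Mean square of quadratic character sums over the odd primes of a dyadic interval. -/
theorem sum_sq_characterSum_le {X N : ℕ} (hX : 0 < X) (hN : 0 < N) (hNX : N ≤ X ^ 2) :
    ∑ p ∈ oddPrimesDyadic X, (∑ a ∈ Icc 1 N, oddJacobi a p) ^ 2 ≤
      1100000 * X * N * (1 + Real.log X) := by
  -- At `D ≈ √X` both the edge blocks and the dual sum have length of order `√X`, the limit of the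
  -- mean square inequality.
  set D := X.sqrt + 1 with hDdef
  have hDX : X ≤ D ^ 2 := by rw [sq]; exact (Nat.lt_succ_sqrt X).le
  have hD4 : D ^ 2 ≤ 4 * X := by
    have h1 := Nat.sqrt_le X
    have h2 : X.sqrt ≤ X := Nat.sqrt_le_self X
    rw [hDdef]
    nlinarith
  have hD : 0 < D := by omega
  have hlogX : 0 ≤ Real.log X := Real.log_natCast_nonneg X
  have hB : 0 ≤ (X : ℝ) * N * (1 + Real.log X) := by positivity
  rcases le_total N D with hND | hDN
  · have := sum_sq_oddJacobi_primes_le (A := Icc 1 N) (L := N) (K := N) subset_rfl (by simp) hX hN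
      (by omega) (by nlinarith)
    refine this.trans ?_
    linarith
  · have hDr : (0 : ℝ) < (D : ℝ) ^ 4 := by positivity
    refine le_of_mul_le_mul_left ?_ hDr
    rw [mul_sum]
    have hedge : ∀ i ∈ Icc 1 D, ∀ j ∈ Icc 1 D, ∑ p ∈ oddPrimesDyadic X,
        ((∑ b ∈ Icc 1 (i + j), oddJacobi b p) ^ 2 +
          (∑ b ∈ Ioc N (N + (i + j)), oddJacobi b p) ^ 2) ≤ 4200 * (X * N * (1 + Real.log X)) := by
      intro i hi j hj
      have hi := mem_Icc.1 hi
      have hj := mem_Icc.1 hj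
      have e1 := sum_sq_oddJacobi_primes_le (A := Icc 1 (i + j)) (L := 3 * N) (K := 2 * D)
        (fun b => by simp only [mem_Icc]; omega) (by simp; omega) hX (by omega) (by omega)
        (by nlinarith)
      have e2 := sum_sq_oddJacobi_primes_le (A := Ioc N (N + (i + j))) (L := 3 * N) (K := 2 * D)
        (fun b => by simp only [mem_Icc, mem_Ioc]; omega) (by simp; omega) hX (by omega) (by omega)
        (by nlinarith)
      push_cast at e1 e2
      rw [sum_add_distrib]
      linarith
    calc _ ≤ ∑ p ∈ oddPrimesDyadic X,
          (2 * (∑ i ∈ Icc 1 D, ∑ j ∈ Icc 1 D, ∑ b ∈ Icc 1 N, oddJacobi (b + i + j) p) ^ 2 +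
          4 * D ^ 2 * ∑ i ∈ Icc 1 D, ∑ j ∈ Icc 1 D, ((∑ b ∈ Icc 1 (i + j), oddJacobi b p) ^ 2 +
            (∑ b ∈ Ioc N (N + (i + j)), oddJacobi b p) ^ 2)) :=
          sum_le_sum fun p _ => sq_sum_le_of_smoothing (fun b => oddJacobi b p) hD
      _ = 2 * ∑ p ∈ oddPrimesDyadic X,
          (∑ i ∈ Icc 1 D, ∑ j ∈ Icc 1 D, ∑ b ∈ Icc 1 N, oddJacobi (b + i + j) p) ^ 2 +
          4 * D ^ 2 * ∑ i ∈ Icc 1 D, ∑ j ∈ Icc 1 D, ∑ p ∈ oddPrimesDyadic X,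
            ((∑ b ∈ Icc 1 (i + j), oddJacobi b p) ^ 2 +
              (∑ b ∈ Ioc N (N + (i + j)), oddJacobi b p) ^ 2) := by
          rw [sum_add_distrib, ← mul_sum, ← mul_sum, sum_comm]
          congr 2
          refine sum_congr rfl fun i _ => ?_
          rw [sum_comm]
      _ ≤ 2 * (D ^ 4 * (520000 * X * N * (1 + Real.log X))) +
          4 * D ^ 2 * ∑ i ∈ Icc 1 D, ∑ j ∈ Icc 1 D, 4200 * (X * N * (1 + Real.log X)) := by
          gcongr with i hi j hj
          · exact sum_sq_sum_triple_le hX hDX hDN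
          · exact hedge i hi j hj
      _ = (D : ℝ) ^ 4 * (1056800 * (X * N * (1 + Real.log X))) := by
          simp only [sum_const, Nat.card_Icc, nsmul_eq_mul, Nat.add_sub_cancel]
          ring
      _ ≤ (D : ℝ) ^ 4 * (1100000 * X * N * (1 + Real.log X)) := by
          refine mul_le_mul_of_nonneg_left ?_ hDr.le
          linarith

/-! ### The first moment over primes. -/

theorem abs_characterSum_le {p : ℕ} (hp : p.Prime) (hodd : Odd p) (N : ℕ) :
    |∑ a ∈ Icc 1 N, oddJacobi a p| ≤ 2 * p := by
  have : Fact p.Prime := ⟨hp⟩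
  have h := norm_sum_le_of_isPrimitive hp.one_lt (complexQuadraticChar_isPrimitive hodd) N
  simp_rw [complexQuadraticChar_natCast hodd] at h
  rw [← Complex.ofReal_sum, Complex.norm_real, Real.norm_eq_abs] at h
  have hp0 : (0 : ℝ) < p := by exact_mod_cast hp.pos
  have hs : 0 < √(p : ℝ) := Real.sqrt_pos.2 hp0
  have hss : √(p : ℝ) * √p = p := Real.mul_self_sqrt hp0.le
  have hl : 1 + Real.log p ≤ 2 * √p := by
    have := Real.log_le_sub_one_of_pos hs
    rw [Real.log_sqrt hp0.le] at this
    linarith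
  calc _ ≤ √(p : ℝ) * (2 * √p) := h.trans (by gcongr)
    _ = 2 * p := by rw [mul_left_comm, hss]

/-- Cauchy–Schwarz when `N ≤ X²`, where `1049² ≥ 1100000`. For larger `N` each character sum is at
most `2p ≤ 4X ≤ 4√N`. -/
theorem sum_abs_characterSum_dyadic_le {X N : ℕ} (hX : 0 < X) (hN : 0 < N) :
    ∑ p ∈ oddPrimesDyadic X, |∑ a ∈ Icc 1 N, oddJacobi a p| ≤
      1049 * X * √(N * (1 + Real.log X)) := by
  have hX' : (1 : ℝ) ≤ X := by exact_mod_cast hX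
  have hN' : (1 : ℝ) ≤ N := by exact_mod_cast hN
  have hlogX : 0 ≤ Real.log X := Real.log_natCast_nonneg X
  have hcard : (#(oddPrimesDyadic X) : ℝ) ≤ X := by
    have := card_filter_le (Ioc X (2 * X)) (fun p => p.Prime ∧ Odd p)
    rw [Nat.card_Ioc] at this
    exact_mod_cast (this.trans (by omega) : #(oddPrimesDyadic X) ≤ X)
  rcases le_total N (X ^ 2) with h | h
  · have hCS := sq_sum_le_card_mul_sum_sq (s := oddPrimesDyadic X)
      (f := fun p => |∑ a ∈ Icc 1 N, oddJacobi a p|)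
    simp_rw [sq_abs] at hCS
    have hms := sum_sq_characterSum_le hX hN h
    refine le_of_sq_le_sq ?_ (by positivity)
    calc _ ≤ (X : ℝ) * (1100000 * X * N * (1 + Real.log X)) := by
          refine hCS.trans ?_
          gcongr
      _ = 1100000 * (X ^ 2 * (N * (1 + Real.log X))) := by ring
      _ ≤ 1049 ^ 2 * (X ^ 2 * (N * (1 + Real.log X))) := by gcongr; norm_num
      _ = _ := by rw [mul_pow, mul_pow, Real.sq_sqrt (by positivity)]; ring
  · have hXN : (X : ℝ) ≤ √(N * (1 + Real.log X)) := by
      apply Real.le_sqrt_of_sq_le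
      have : (X : ℝ) ^ 2 ≤ N := by exact_mod_cast h
      nlinarith
    calc _ ≤ ∑ p ∈ oddPrimesDyadic X, (4 * X : ℝ) := by
          refine sum_le_sum fun p hp => ?_
          obtain ⟨hpm, hpp, hodd⟩ := mem_filter.1 hp
          refine (abs_characterSum_le hpp hodd N).trans ?_
          have : (p : ℝ) ≤ 2 * X := by exact_mod_cast (mem_Ioc.1 hpm).2
          linarith
      _ = #(oddPrimesDyadic X) * (4 * X : ℝ) := by rw [sum_const, nsmul_eq_mul]
      _ ≤ X * (4 * √(N * (1 + Real.log X))) := by gcongr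
      _ ≤ _ := by nlinarith [Real.sqrt_nonneg (N * (1 + Real.log X))]

/-- The odd primes up to `n`. -/
def oddPrimesUpTo (n : ℕ) : Finset ℕ := {p ∈ Icc 1 n | p.Prime ∧ Odd p}

theorem sum_abs_characterSum_le {N : ℕ} (hN : 0 < N) {Λ : ℝ} (n : ℕ) (hn : 0 < n)
    (hΛ : 1 + Real.log n ≤ Λ) :
    ∑ p ∈ oddPrimesUpTo n, |∑ a ∈ Icc 1 N, oddJacobi a p| ≤ 2098 * (n - 1) * √(N * Λ) := by
  induction n using Nat.strong_induction_on with
  | _ n ih =>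
    rcases Nat.lt_or_ge 1 n with h1 | h1
    -- Rounding up ensures `n ≤ 2X`, so `(X, 2X]` covers what the induction hypothesis misses; `3X ≤
    -- 2n` closes the induction.
    · set X := (n + 1) / 2 with hXdef
      have hX : 0 < X := by omega
      have hXn : X < n := by omega
      have hlog : Real.log X ≤ Real.log n :=
        Real.log_le_log (by exact_mod_cast hX) (by exact_mod_cast hXn.le)
      have hih := ih X hXn hX (by linarith)
      have hblock := sum_abs_characterSum_dyadic_le hX hN
      have hsub : oddPrimesUpTo n ⊆ oddPrimesUpTo X ∪ oddPrimesDyadic X := by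
        intro p
        simp only [oddPrimesUpTo, oddPrimesDyadic, mem_union, mem_filter, mem_Icc, mem_Ioc]
        rintro ⟨⟨hp1, hpn⟩, hp⟩
        rcases le_or_gt p X with h | h
        · exact Or.inl ⟨⟨hp1, h⟩, hp⟩
        · exact Or.inr ⟨⟨h, by omega⟩, hp⟩
      have hs : √(N * (1 + Real.log X)) ≤ √(N * Λ) := by
        apply Real.sqrt_le_sqrt
        gcongr
        linarith
      have hs0 := Real.sqrt_nonneg (N * Λ)
      have hreal : (2 : ℝ) * (X - 1) + X ≤ 2 * (n - 1) := by
        have : 2 * X + X ≤ 2 * n := by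
          rcases Nat.lt_or_ge 3 n with h | h
          · omega
          · interval_cases n <;> omega
        have : ((2 * X + X : ℕ) : ℝ) ≤ ((2 * n : ℕ) : ℝ) := by exact_mod_cast this
        push_cast at this
        linarith
      calc _ ≤ ∑ p ∈ oddPrimesUpTo X ∪ oddPrimesDyadic X, |∑ a ∈ Icc 1 N, oddJacobi a p| :=
            sum_le_sum_of_subset_of_nonneg hsub fun _ _ _ => abs_nonneg _
        _ ≤ ∑ p ∈ oddPrimesUpTo X, |∑ a ∈ Icc 1 N, oddJacobi a p| +
            ∑ p ∈ oddPrimesDyadic X, |∑ a ∈ Icc 1 N, oddJacobi a p| := by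
            rw [← sum_union_inter]
            exact le_add_of_nonneg_right (sum_nonneg fun _ _ => abs_nonneg _)
        _ ≤ 2098 * (X - 1) * √(N * Λ) + 1049 * X * √(N * Λ) := by
            refine add_le_add hih (hblock.trans ?_)
            gcongr
        _ = 1049 * (2 * (X - 1) + X) * √(N * Λ) := by ring
        _ ≤ 1049 * (2 * (n - 1)) * √(N * Λ) := by gcongr
        _ = _ := by ring
    · have : n = 1 := by omega
      subst this
      have : oddPrimesUpTo 1 = ∅ := by
        ext p
        simp only [oddPrimesUpTo, mem_filter, mem_Icc, notMem_empty, iff_false]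
        rintro ⟨⟨h1, h2⟩, hp, _⟩
        have := hp.one_lt
        omega
      rw [this]
      simp

/-! ### Euler's criterion and the conclusion. -/

theorem residuePrimeCount_two_eq (a : ℤ) (x : ℝ) :
    residuePrimeCount a 2 x =
      #((oddPrimesUpTo ⌊x⌋₊).filter fun p : ℕ => a ^ ((p - 1) / 2) ≡ 1 [ZMOD (p : ℤ)]) := by
  rw [residuePrimeCount, ← Set.ncard_coe_finset]
  congr 1
  ext p
  simp only [residuePrimes, oddPrimesUpTo, coe_filter, mem_filter, mem_Icc, Set.mem_ofPred_eq]
  have hodd : p ≡ 1 [MOD 2] ↔ Odd p := by rw [Nat.odd_iff]; rfl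
  rw [hodd]
  constructor
  · rintro ⟨⟨hp, ho, hr⟩, hx⟩
    exact ⟨⟨⟨hp.one_lt.le, Nat.le_floor hx⟩, hp, ho⟩, hr⟩
  · rintro ⟨⟨⟨h1, hx⟩, hp, ho⟩, hr⟩
    exact ⟨⟨hp, ho, hr⟩, (Nat.le_floor_iff' hp.ne_zero).1 hx⟩

theorem ite_pow_modEq_one_eq {p : ℕ} (hp : p.Prime) (hodd : Odd p) (a : ℕ) :
    (if (a : ℤ) ^ ((p - 1) / 2) ≡ 1 [ZMOD (p : ℤ)] then (1 : ℝ) else 0) =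
      (1 + oddJacobi a p - if p ∣ a then 1 else 0) / 2 := by
  have : Fact p.Prime := ⟨hp⟩
  have hp2 : 2 < p := by
    have := hp.two_le
    rcases hodd with ⟨k, rfl⟩
    omega
  have : Fact (2 < p) := ⟨hp2⟩
  have hexp : (p - 1) / 2 = p / 2 := by
    rcases hodd with ⟨k, rfl⟩
    omega
  have hmod : (a : ℤ) ^ ((p - 1) / 2) ≡ 1 [ZMOD (p : ℤ)] ↔ (legendreSym p a : ZMod p) = 1 := by
    rw [← ZMod.intCast_eq_intCast_iff, legendreSym.eq_pow, hexp]
    push_cast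
    rfl
  have hJ : oddJacobi a p = (legendreSym p a : ℝ) := by
    rw [oddJacobi, if_pos hodd, jacobiSym.legendreSym.to_jacobiSym]
  have hdvd : (((a : ℕ) : ℤ) : ZMod p) = 0 ↔ p ∣ a := by
    rw [Int.cast_natCast, ZMod.natCast_eq_zero_iff]
  simp only [hmod]
  rw [hJ]
  by_cases hpa : p ∣ a
  · rw [(legendreSym.eq_zero_iff p a).2 (hdvd.2 hpa), if_pos hpa]
    simp
  · rw [if_neg hpa]
    rcases legendreSym.eq_one_or_neg_one p (a := (a : ℤ)) (by rwa [Ne, hdvd]) with h | h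
    · rw [h]; simp
    · rw [h]
      have : ((-1 : ℤ) : ZMod p) ≠ 1 := by
        push_cast
        exact ZMod.neg_one_ne_one
      rw [if_neg this]
      simp

/-- Exchange summations and insert Euler's criterion. The `-2` removes `a = 1`, which is counted for
every odd prime but lies outside the range of `a`. -/
theorem sum_residuePrimeCount_two_eq {N : ℕ} (hN : 0 < N) (x : ℝ) :
    ∑ a ∈ Icc (2 : ℤ) N, (residuePrimeCount a 2 x : ℝ) =
      ∑ p ∈ oddPrimesUpTo ⌊x⌋₊,
        ((N : ℝ) - 2 + ∑ a ∈ Icc 1 N, oddJacobi a p - (N / p : ℕ)) / 2 := by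
  have h1 : ∑ a ∈ Icc (2 : ℤ) N, (residuePrimeCount a 2 x : ℝ) =
      ∑ a ∈ Icc 2 N, (residuePrimeCount (a : ℤ) 2 x : ℝ) := by
    refine sum_nbij' Int.toNat (fun a : ℕ => (a : ℤ)) ?_ ?_ ?_ ?_ ?_
    · intro a; simp only [mem_Icc]; omega
    · intro a; simp only [mem_Icc]; omega
    · intro a; simp only [mem_Icc]; omega
    · simp
    · intro a ha
      rw [Int.toNat_of_nonneg (by have := (mem_Icc.1 ha).1; omega)]
  rw [h1]
  simp_rw [residuePrimeCount_two_eq, card_filter, Nat.cast_sum]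
  rw [sum_comm]
  refine sum_congr rfl fun p hp => ?_
  obtain ⟨-, hpp, hodd⟩ := mem_filter.1 hp
  have hind : ∀ a : ℕ, (((if (a : ℤ) ^ ((p - 1) / 2) ≡ 1 [ZMOD (p : ℤ)] then 1 else 0 : ℕ)) : ℝ) =
      (1 + oddJacobi a p - if p ∣ a then 1 else 0) / 2 := by
    intro a
    rw [← ite_pow_modEq_one_eq hpp hodd a]
    push_cast
    rfl
  simp_rw [hind]
  have hsplit : ∀ f : ℕ → ℝ, ∑ a ∈ Icc 1 N, f a = f 1 + ∑ a ∈ Icc 2 N, f a := by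
    intro f
    rw [← Finset.insert_Icc_succ_left_eq_Icc (by omega : 1 ≤ N), sum_insert (by simp)]
    rfl
  have hone : (1 + oddJacobi 1 p - if p ∣ 1 then 1 else 0) / 2 = (1 : ℝ) := by
    rw [if_neg (by rw [Nat.dvd_one]; exact hpp.ne_one), oddJacobi, if_pos hodd]
    norm_num [jacobiSym.one_left]
  have hfull := hsplit (fun a => (1 + oddJacobi a p - if p ∣ a then 1 else 0) / 2)
  rw [hone] at hfull
  have hcount : ∑ a ∈ Icc 1 N, (if p ∣ a then (1 : ℝ) else 0) = (N / p : ℕ) := by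
    rw [← sum_filter, sum_Icc_filter_dvd _ hpp.pos]
    simp
  have hval : ∑ a ∈ Icc 1 N, (1 + oddJacobi a p - if p ∣ a then (1 : ℝ) else 0) / 2 =
      ((N : ℝ) + ∑ a ∈ Icc 1 N, oddJacobi a p - (N / p : ℕ)) / 2 := by
    rw [← sum_div, sum_sub_distrib, sum_add_distrib, hcount]
    simp
  linarith

theorem abs_card_oddPrimesUpTo_sub_primeCounting_le (n : ℕ) :
    |(#(oddPrimesUpTo n) : ℝ) - Nat.primeCounting n| ≤ 1 := by
  have h1 : Nat.primeCounting n = #{p ∈ range (n + 1) | p.Prime} := by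
    rw [Nat.primeCounting, Nat.primeCounting', Nat.count_eq_card_filter_range]
  have h2 : oddPrimesUpTo n ⊆ {p ∈ range (n + 1) | p.Prime} := by
    intro p
    simp only [oddPrimesUpTo, mem_filter, mem_Icc, mem_range]
    rintro ⟨⟨_, h⟩, hp, _⟩
    exact ⟨by omega, hp⟩
  have h3 : {p ∈ range (n + 1) | p.Prime} ⊆ insert 2 (oddPrimesUpTo n) := by
    intro p
    simp only [oddPrimesUpTo, mem_filter, mem_Icc, mem_range, mem_insert]
    rintro ⟨h, hp⟩
    rcases hp.eq_two_or_odd' with h2 | h2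
    · exact Or.inl h2
    · exact Or.inr ⟨⟨hp.one_lt.le, by omega⟩, hp, h2⟩
  have h4 := card_le_card h2
  have h5 := (card_le_card h3).trans (card_insert_le _ _)
  rw [← h1] at h4 h5
  have h4' : (#(oddPrimesUpTo n) : ℝ) ≤ Nat.primeCounting n := by exact_mod_cast h4
  have h5' : (Nat.primeCounting n : ℝ) ≤ #(oddPrimesUpTo n) + 1 := by exact_mod_cast h5
  rw [abs_le]
  constructor <;> linarith

theorem abs_average_sub_le {x y : ℝ} (hx : 2 ≤ x) (hy : 1 ≤ y) :
    |(1 / y) * ∑ a ∈ Icc (2 : ℤ) ⌊y⌋, (residuePrimeCount a 2 x : ℝ)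
      - (Nat.primeCounting ⌊x⌋₊ : ℝ) / 2| ≤
      3 / 2 * (x / y) + 1049 * (x * √((1 + Real.log x) / y)) + (1 + Real.log x) / 2 + 1 / 2 := by
  have hy0 : 0 < y := by linarith
  set N := ⌊y⌋₊ with hNdef
  set n := ⌊x⌋₊ with hndef
  have hN : 0 < N := Nat.floor_pos.2 hy
  have hn : 0 < n := Nat.floor_pos.2 (by linarith)
  have hNy : (N : ℝ) ≤ y := Nat.floor_le hy0.le
  have hyN : y < N + 1 := Nat.lt_floor_add_one y
  have hnx : (n : ℝ) ≤ x := Nat.floor_le (by linarith)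
  have hfl : ⌊y⌋ = (N : ℤ) := (Int.natCast_floor_eq_floor hy0.le).symm
  rw [hfl, sum_residuePrimeCount_two_eq hN]
  set P := oddPrimesUpTo n
  set S : ℕ → ℝ := fun p => ∑ a ∈ Icc 1 N, oddJacobi a p
  have hlog : Real.log n ≤ Real.log x := Real.log_le_log (by exact_mod_cast hn) hnx
  have hlogx : 0 ≤ Real.log x := Real.log_nonneg (by linarith)
  have hPcard : (#P : ℝ) ≤ x := by
    have : #P ≤ n := (card_filter_le _ _).trans (by simp)
    exact (by exact_mod_cast this : (#P : ℝ) ≤ n).trans hnx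
  have hS : ∑ p ∈ P, |S p| ≤ 2098 * (x * √(y * (1 + Real.log x))) := by
    have := sum_abs_characterSum_le hN (Λ := 1 + Real.log x) n hn (by linarith)
    refine this.trans ?_
    have : √(N * (1 + Real.log x)) ≤ √(y * (1 + Real.log x)) := by
      apply Real.sqrt_le_sqrt; gcongr
    rw [mul_assoc]
    gcongr
    linarith
  have hdiv : ∑ p ∈ P, ((N / p : ℕ) : ℝ) ≤ y * (1 + Real.log x) := by
    calc _ ≤ ∑ p ∈ P, (N : ℝ) * (1 / p) := by
          refine sum_le_sum fun p _ => Nat.cast_div_le.trans (le_of_eq ?_)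
          rw [mul_one_div]
      _ ≤ ∑ p ∈ Icc 1 n, (N : ℝ) * (1 / p) :=
          sum_le_sum_of_subset_of_nonneg (filter_subset _ _) fun _ _ _ => by positivity
      _ ≤ y * (1 + Real.log x) := by
          rw [← mul_sum]
          have := sum_Icc_inv_le n
          gcongr
          linarith
  have hdiv0 : 0 ≤ ∑ p ∈ P, ((N / p : ℕ) : ℝ) := sum_nonneg fun _ _ => by positivity
  have hSabs : |∑ p ∈ P, S p| ≤ ∑ p ∈ P, |S p| := abs_sum_le_sum_abs _ _
  have hpi := abs_card_oddPrimesUpTo_sub_primeCounting_le n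
  have hT : ∑ p ∈ P, ((N : ℝ) - 2 + S p - (N / p : ℕ)) / 2 =
      (#P * (N - 2) + ∑ p ∈ P, S p - ∑ p ∈ P, ((N / p : ℕ) : ℝ)) / 2 := by
    rw [← sum_div, sum_sub_distrib, sum_add_distrib, sum_const, nsmul_eq_mul]
  rw [hT]
  set Q : ℝ := (Nat.primeCounting n : ℝ)
  set A := ∑ p ∈ P, S p
  set B := ∑ p ∈ P, ((N / p : ℕ) : ℝ)
  have hsq : √((1 + Real.log x) / y) = √(y * (1 + Real.log x)) / y := by
    rw [eq_div_iff hy0.ne', ← Real.sqrt_sq hy0.le, ← Real.sqrt_mul (by positivity),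
      Real.sqrt_sq hy0.le]
    congr 1
    field_simp
  rw [hsq]
  -- Here `N - 2 - y` lies in `[-3, 0]`, which yields the `x / y` term, and `#P - Q` is at most 1 in
  -- absolute value because only the prime 2 is missing.
  have hid : 1 / y * ((#P * (N - 2) + A - B) / 2) - Q / 2 =
      ((#P * (N - 2 - y)) + A - B) / (2 * y) + (#P - Q) / 2 := by
    field_simp
    ring
  rw [hid]
  have hc0 : (0 : ℝ) ≤ #P := by positivity
  have hfirst : |(#P : ℝ) * (N - 2 - y) + A - B| ≤
      3 * x + 2098 * (x * √(y * (1 + Real.log x))) + y * (1 + Real.log x) := by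
    have hA := abs_le.1 (hSabs.trans hS)
    have h1 : (#P : ℝ) * (N - 2 - y) ≤ 0 := mul_nonpos_of_nonneg_of_nonpos hc0 (by linarith)
    have h2 : -(3 * x) ≤ (#P : ℝ) * (N - 2 - y) := by nlinarith
    have h3 : 0 ≤ y * (1 + Real.log x) := by positivity
    rw [abs_le]
    constructor <;> linarith
  calc _ ≤ |(#P : ℝ) * (N - 2 - y) + A - B| / (2 * y) + |#P - Q| / 2 := by
        refine (abs_add_le _ _).trans ?_
        rw [abs_div, abs_div, abs_of_pos (by positivity : 0 < 2 * y), abs_two]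
    _ ≤ (3 * x + 2098 * (x * √(y * (1 + Real.log x))) + y * (1 + Real.log x)) / (2 * y) + 1 / 2 := by
        gcongr
    _ = _ := by field_simp; ring

theorem abs_average_sub_eq_zero {x : ℝ} (hx : x < 2) (y : ℝ) :
    |(1 / y) * ∑ a ∈ Icc (2 : ℤ) ⌊y⌋, (residuePrimeCount a 2 x : ℝ)
      - (Nat.primeCounting ⌊x⌋₊ : ℝ) / 2| = 0 := by
  have hn : ⌊x⌋₊ < 2 := Nat.floor_lt' (by norm_num) |>.2 (by exact_mod_cast hx)
  have h1 : ∀ a : ℤ, residuePrimeCount a 2 x = 0 := by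
    intro a
    rw [residuePrimeCount_two_eq, card_eq_zero, filter_eq_empty_iff]
    intro p hp
    obtain ⟨hp1, hp2, _⟩ := mem_filter.1 hp
    have := hp2.two_le
    have := (mem_Icc.1 hp1).2
    omega
  have h2 : Nat.primeCounting ⌊x⌋₊ = 0 := Nat.primeCounting_eq_zero_iff.2 (by omega)
  simp [h1, h2]

theorem theorem2p1 :
    ∃ C : ℝ, 0 < C ∧ ∀ x y : ℝ, 1 < x → 1 ≤ y →
      (y ≤ x / Real.log x →
        |(1 / y) * ∑ a ∈ Finset.Icc (2 : ℤ) ⌊y⌋, (residuePrimeCount a 2 x : ℝ)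
            - (Nat.primeCounting ⌊x⌋₊ : ℝ) / 2| ≤ C * (x * Real.sqrt (Real.log x / y))) ∧
      (x / Real.log x < y →
        |(1 / y) * ∑ a ∈ Finset.Icc (2 : ℤ) ⌊y⌋, (residuePrimeCount a 2 x : ℝ)
            - (Nat.primeCounting ⌊x⌋₊ : ℝ) / 2| ≤ C * (Real.sqrt x * Real.log x)) := by
  -- In either range the terms of `abs_average_sub_le` total less than 2110 times the target.
  refine ⟨3000, by norm_num, fun x y hx1 hy => ?_⟩
  have hlpos : 0 < Real.log x := Real.log_pos hx1
  have hy0 : 0 < y := by linarith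
  have hx0 : 0 < x := by linarith
  -- Below 2 the left side vanishes; this case is separated because `1 + log x` is not `O(log x)` as
  -- `x` tends to 1.
  rcases lt_or_ge x 2 with hx | hx
  · rw [abs_average_sub_eq_zero hx y]
    exact ⟨fun _ => by positivity, fun _ => by positivity⟩
  have hmain := abs_average_sub_le hx hy
  set l := Real.log x with hl
  have hl2 : 1 / 2 ≤ l := by
    have := Real.log_le_log (by norm_num) hx
    have := Real.log_two_gt_d9
    linarith
  have hl3 : 1 + l ≤ 4 * l := by linarith
  have hsx : 1 ≤ √x := Real.one_le_sqrt.2 hx1.le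
  have hss : √x * √x = x := Real.mul_self_sqrt hx0.le
  -- The two targets `R` and `√x * l` coincide at `y = x / l`; `R` is the larger one below this
  -- threshold and the smaller one above it.
  set R := x * √(l / y) with hR
  have hR4 : x * √((1 + l) / y) ≤ 2 * R := by
    have : √((1 + l) / y) ≤ 2 * √(l / y) := by
      have h4 : (2 : ℝ) = √4 := by
        rw [show (4 : ℝ) = 2 ^ 2 by norm_num, Real.sqrt_sq (by norm_num)]
      rw [h4, ← Real.sqrt_mul (by norm_num)]
      apply Real.sqrt_le_sqrt
      rw [← mul_div_assoc]
      gcongr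
    rw [hR]
    nlinarith
  have hlsx : l ≤ √x * l := le_mul_of_one_le_left hlpos.le hsx
  constructor
  · intro hyx
    have hyl : y * l ≤ x := (le_div_iff₀ hlpos).1 hyx
    have hR1 : √x * l ≤ R := by
      have : l / √x ≤ √(l / y) := by
        apply Real.le_sqrt_of_sq_le
        rw [div_pow, Real.sq_sqrt hx0.le, div_le_div_iff₀ hx0 hy0]
        nlinarith
      calc √x * l = x * (l / √x) := by
            rw [← mul_div_assoc, eq_div_iff (by positivity)]
            nlinarith
        _ ≤ R := by rw [hR]; gcongr
    have hR2 : x / y ≤ 2 * R := by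
      have : 1 / y ≤ 2 * √(l / y) := by
        have h4 : 1 / y / 2 ≤ √(l / y) := by
          apply Real.le_sqrt_of_sq_le
          rw [div_div, div_pow, one_pow, div_le_div_iff₀ (by positivity) hy0]
          nlinarith [mul_pos hlpos hy0]
        linarith
      calc x / y = x * (1 / y) := by ring
        _ ≤ x * (2 * √(l / y)) := by gcongr
        _ = 2 * R := by rw [hR]; ring
    linarith
  · intro hyx
    have hyl : x < y * l := (div_lt_iff₀ hlpos).1 hyx
    have hR1 : R ≤ √x * l := by
      have : √(l / y) ≤ l / √x := by
        rw [Real.sqrt_le_left (by positivity), div_pow, Real.sq_sqrt hx0.le,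
          div_le_div_iff₀ hy0 hx0]
        nlinarith
      calc R ≤ x * (l / √x) := by rw [hR]; gcongr
        _ = √x * l := by
            rw [← mul_div_assoc, div_eq_iff (by positivity)]
            nlinarith
    have hxy : x / y ≤ l := by
      rw [div_le_iff₀ hy0]; linarith
    linarith
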